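/- **Proposition 4.3 (Generalised Gauss–Bonnet Theorem).** Let $\eta_{ab}$ be the Minkowski metric of $\mathbb{M}=\mathbb{R}^4$, with signature $(+,-,-,-)$, and let $S$ be a space-like 2-sphere in $\mathbb{M}$, i.e. the image of a smooth map $S^2\to\mathbb{M}$ whose differential sends nonzero tangent vectors to space-like vectors (an embedding or, more generally, an immersion; in the latter case integrals over $S$ are taken over the parametrising $S^2$). Let $dA$ be the area element of the induced positive-definite metric on $S$. Let $\ell^a,n^a$ be smooth future-pointing null normal fields to $S$ with $\ell_an^a=1$, and let $m^a=\frac{1}{\sqrt2}(e_1^a+i\,e_2^a)$, where at each point $(e_1,e_2)$ is an orthonormal basis of the tangent plane of $S$ such that $(n,e_1,e_2,\ell)$ is positively oriented. Put $$\rho=m^a\overline m^b\nabla_b\ell_a,\quad \sigma=m^am^b\nabla_b\ell_a,\quad \rho'=\overline m^am^b\nabla_bn_a,\quad \sigma'=\overline m^a\overline m^b\nabla_bn_a .$$ Then, for every constant time-like vector $t^a$, $$\int_S\frac{\rho^2-\sigma\overline\sigma}{(t^a\ell_a)^2}\,dA=\int_S\frac{\rho'^2-\sigma'\overline{\sigma}'}{(t^an_a)^2}\,dA=\frac{4\pi}{t^at_a},\qquad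 \int_S(-\rho\rho'+\sigma\sigma')\,dA=2\pi .$$ -/

import Mathlib

open scoped ContDiff RealInnerProductSpace

noncomputable section

namespace SpacelikeTwoSphere

/-- Euclidean three-space; its unit sphere is the model two-sphere. -/
abbrev E3 : Type := EuclideanSpace ℝ (Fin 3)

/-- Vectors (and points) of Minkowski space, in inertial coordinates `(t, x, y, z)`. -/
abbrev Mink : Type := Fin 4 → ℝ

/-- The Minkowski bilinear form `η_ab x^a y^b` of signature `(+,-,-,-)`. It is used over `ℝ`, and over
`ℂ` as the complex bilinear extension (no complex conjugation). -/
def eta {R : Type*} [CommRing R] (x y : Fin 4 → R) : R :=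
  x 0 * y 0 - x 1 * y 1 - x 2 * y 2 - x 3 * y 3

/-- `v` is tangent to the unit sphere at `p`. -/
def IsTangent (p v : E3) : Prop := ⟪p, v⟫ = 0

/-- A smooth space-like two-sphere in Minkowski space: the standard two-sphere mapped smoothly into
Minkowski space so that the differential takes nonzero tangent vectors to space-like vectors (in
particular it is an immersion; embedded spheres are included, injectivity is not demanded).
As usual, a map on the sphere is given by a function on the ambient `ℝ³` smooth at the points of the
sphere; only its values on the sphere, and its derivatives in tangential directions, are ever used. -/
structure SpacelikeSphere where
  /-- the position vector `x^a` -/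
  X : E3 → Mink
  smooth : ∀ p ∈ Metric.sphere (0 : E3) 1, ContDiffAt ℝ ∞ X p
  spacelike : ∀ p ∈ Metric.sphere (0 : E3) 1, ∀ v : E3, IsTangent p v → v ≠ 0 →
    eta (fderiv ℝ X p v) (fderiv ℝ X p v) < 0

namespace SpacelikeSphere

variable (S : SpacelikeSphere)

/-- The induced (positive definite) metric of the surface, `-η(dX u, dX v)`. -/
def metric (p u v : E3) : ℝ := -eta (fderiv ℝ S.X p u) (fderiv ℝ S.X p v)

/-- The Gram determinant of the induced metric on the pair `u, v`. -/
def gram (p u v : E3) : ℝ := S.metric p u u * S.metric p v v - S.metric p u v * S.metric p v u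

/-- The density of the area of the surface with respect to the area of the unit sphere: the square
root of the determinant of the induced metric in an orthonormal basis of the tangent plane of the
unit sphere (by `areaDensity_eq` the choice of this basis is immaterial). -/
def areaDensity (p : Metric.sphere (0 : E3) 1) : ℝ :=
  haveI : Fact (Module.finrank ℝ E3 = 2 + 1) := ⟨by simp⟩
  let b := OrthonormalBasis.fromOrthogonalSpanSingleton (𝕜 := ℝ) 2 (ne_zero_of_mem_unit_sphere p)
  Real.sqrt (S.gram p (b 0 : E3) (b 1 : E3))

theorem areaDensity_eq (p : Metric.sphere (0 : E3) 1) (u v : E3) (hu : IsTangent p u)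
    (hv : IsTangent p v) (huu : ⟪u, u⟫ = 1) (hvv : ⟪v, v⟫ = 1) (huv : ⟪u, v⟫ = 0) :
    S.areaDensity p = Real.sqrt (S.gram p u v) := by
  have : Fact (Module.finrank ℝ E3 = 2 + 1) := ⟨by simp⟩
  unfold areaDensity
  set b := OrthonormalBasis.fromOrthogonalSpanSingleton (𝕜 := ℝ) 2 (ne_zero_of_mem_unit_sphere p)
    with hb
  have key : ∀ w : E3, IsTangent p w →
      w = ⟪(b 0 : E3), w⟫ • (b 0 : E3) + ⟪(b 1 : E3), w⟫ • (b 1 : E3) := by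
    intro w hw
    have hw' : w ∈ (Submodule.span ℝ {(p : E3)})ᗮ :=
      Submodule.mem_orthogonal_singleton_iff_inner_right.2 hw
    have h := congrArg Subtype.val (b.sum_repr' ⟨w, hw'⟩)
    simpa [Fin.sum_univ_two] using h.symm
  have h00 : ⟪(b 0 : E3), (b 0 : E3)⟫ = 1 := 
    (b.inner_eq_ite 0 0).trans (by simp)
  have h11 : ⟪(b 1 : E3), (b 1 : E3)⟫ = 1 := 
    (b.inner_eq_ite 1 1).trans (by simp)
  have h01 : ⟪(b 0 : E3), (b 1 : E3)⟫ = 0 := 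
    (b.inner_eq_ite 0 1).trans (by simp)
  have h10 : ⟪(b 1 : E3), (b 0 : E3)⟫ = 0 := by rw [real_inner_comm]; exact h01
  have hu' := key u hu
  have hv' := key v hv
  generalize ⟪(b 0 : E3), u⟫ = a at hu'
  generalize ⟪(b 1 : E3), u⟫ = c at hu'
  generalize ⟪(b 0 : E3), v⟫ = d at hv'
  generalize ⟪(b 1 : E3), v⟫ = e at hv'
  subst hu' hv'
  simp only [inner_add_left, inner_add_right, real_inner_smul_left, real_inner_smul_right, h00, h01,
    h10, h11] at huu hvv huv
  have hdet : (a * e - c * d) ^ 2 = 1 := by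
    linear_combination (a * d + c * e) * (-huv) + huu * (d * d + e * e) + hvv
  have hg : S.gram p (a • (b 0 : E3) + c • (b 1 : E3)) (d • (b 0 : E3) + e • (b 1 : E3))
      = (a * e - c * d) ^ 2 * S.gram p (b 0) (b 1) := by
    simp only [gram, metric, eta, map_add, map_smul, Pi.add_apply, Pi.smul_apply, smul_eq_mul]
    ring
  rw [hg, hdet, one_mul]

/-- The area measure `dA` of the induced metric, on the parameter sphere. -/
def area : MeasureTheory.Measure (Metric.sphere (0 : E3) 1) :=
  (MeasureTheory.volume : MeasureTheory.Measure E3).toSphere.withDensity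
    fun p => ENNReal.ofReal (S.areaDensity p)

end SpacelikeSphere

/-- A null tetrad `(ℓ, n, m, m̄)` adapted to `S`: `ℓ` and `n` are smooth future-pointing null normal
fields with `ℓ_a n^a = 1`, and `m = (dX e₁ + i dX e₂)/√2`, where `e₁, e₂` is at each point a tangent
frame orthonormal for the induced metric and with the orientation that makes `(n, e₁, e₂, ℓ)`
positive. There is no global continuous such frame on a sphere, so none is demanded: the choice
of `e₁, e₂` at each point is arbitrary. -/
structure NullTetrad (S : SpacelikeSphere) where
  l : E3 → Mink
  n : E3 → Mink
  e₁ : E3 → E3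
  e₂ : E3 → E3
  l_smooth : ∀ p ∈ Metric.sphere (0 : E3) 1, ContDiffAt ℝ ∞ l p
  n_smooth : ∀ p ∈ Metric.sphere (0 : E3) 1, ContDiffAt ℝ ∞ n p
  l_null : ∀ p ∈ Metric.sphere (0 : E3) 1, eta (l p) (l p) = 0
  n_null : ∀ p ∈ Metric.sphere (0 : E3) 1, eta (n p) (n p) = 0
  l_future : ∀ p ∈ Metric.sphere (0 : E3) 1, 0 < l p 0
  n_future : ∀ p ∈ Metric.sphere (0 : E3) 1, 0 < n p 0
  l_n : ∀ p ∈ Metric.sphere (0 : E3) 1, eta (l p) (n p) = 1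
  l_normal : ∀ p ∈ Metric.sphere (0 : E3) 1, ∀ v, IsTangent p v →
    eta (l p) (fderiv ℝ S.X p v) = 0
  n_normal : ∀ p ∈ Metric.sphere (0 : E3) 1, ∀ v, IsTangent p v →
    eta (n p) (fderiv ℝ S.X p v) = 0
  e₁_tangent : ∀ p ∈ Metric.sphere (0 : E3) 1, IsTangent p (e₁ p)
  e₂_tangent : ∀ p ∈ Metric.sphere (0 : E3) 1, IsTangent p (e₂ p)
  e₁_unit : ∀ p ∈ Metric.sphere (0 : E3) 1, S.metric p (e₁ p) (e₁ p) = 1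
  e₂_unit : ∀ p ∈ Metric.sphere (0 : E3) 1, S.metric p (e₂ p) (e₂ p) = 1
  e₁_e₂ : ∀ p ∈ Metric.sphere (0 : E3) 1, S.metric p (e₁ p) (e₂ p) = 0
  oriented : ∀ p ∈ Metric.sphere (0 : E3) 1,
    0 < (Matrix.of ![n p, fderiv ℝ S.X p (e₁ p), fderiv ℝ S.X p (e₂ p), l p]).det

namespace NullTetrad

variable {S : SpacelikeSphere} (T : NullTetrad S)

/-- The derivative `δF = m^b ∇_b F` along `m` of a vector field `F` on the surface. -/
def del (F : E3 → Mink) (p : E3) : Fin 4 → ℂ := fun i =>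
  ((fderiv ℝ F p (T.e₁ p) i : ℂ) + Complex.I * (fderiv ℝ F p (T.e₂ p) i : ℂ)) / (Real.sqrt 2 : ℂ)

/-- The derivative `δ̄F = m̄^b ∇_b F` along `m̄` of a vector field `F` on the surface. -/
def delBar (F : E3 → Mink) (p : E3) : Fin 4 → ℂ := fun i =>
  ((fderiv ℝ F p (T.e₁ p) i : ℂ) - Complex.I * (fderiv ℝ F p (T.e₂ p) i : ℂ)) / (Real.sqrt 2 : ℂ)

/-- The complex null tangent vector `m^a = δ x^a`. -/
def m (p : E3) : Fin 4 → ℂ := T.del S.X p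

/-- The complex conjugate tangent vector `m̄^a = δ̄ x^a`. -/
def mBar (p : E3) : Fin 4 → ℂ := T.delBar S.X p

/-- `ρ = m^a m̄^b ∇_b ℓ_a`. -/
def rho (p : E3) : ℂ := eta (T.m p) (T.delBar T.l p)

/-- `σ = m^a m^b ∇_b ℓ_a`. -/
def sigma (p : E3) : ℂ := eta (T.m p) (T.del T.l p)

/-- `ρ' = m̄^a m^b ∇_b n_a`. -/
def rho' (p : E3) : ℂ := eta (T.mBar p) (T.del T.n p)

/-- `σ' = m̄^a m̄^b ∇_b n_a`. -/
def sigma' (p : E3) : ℂ := eta (T.mBar p) (T.delBar T.n p)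

end NullTetrad

end SpacelikeTwoSphere

end

/-!
The proof is Gauss–Bonnet by transgression. Let `E` be a bundle of space-like planes over the sphere
`S²`, contained in the trivial bundle with fibre Minkowski space, and let `F : TS² → E` be a global
isometry. In a local orthonormal frame `u, v` of `TS²` the connection form of `E` (with respect to
`F u, F v`) minus that of the round sphere does not depend on the frame, so it is a global one-form.
By Stokes' theorem the curvature of `E` has the same integral as that of the round sphere, `4π`. If
`E` is the orthogonal complement of two null fields, its curvature is given by the Gauss equation in
terms of the two second fundamental forms: this is `IsTangentIsometry.integral_mixedDet`.

For the surface itself, `E` is the tangent bundle of `S`, and `F` is the isometric factor of the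
polar decomposition of `dX` (`SpacelikeSphere.isometry`). The integral of the real part of
`-ρρ' + σσ'`, which is half the Gauss curvature, follows. The imaginary part is, up to a constant
sign, the exterior derivative of the global one-form `½ n_a dℓ^a`, so its integral is zero.

For the two other integrals, `E` is the complement of `ℓ` and the constant vector `t`. The tangent
bundle of `S` is mapped to it isometrically by adding multiples of `ℓ`. As `t` is constant, the
curvature of `E` involves only the second fundamental form along `ℓ`, whose determinant is
`ρ² - σσ̄`, and equals `t_a t^a (ρ² - σσ̄) / (t_a ℓ^a)²`: this is `SpacelikeSphere.integral_normalDet`.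

Stokes' theorem is used for two-forms `df ∧ dg` (`integral_bracket_sphere`). It follows from
integration by parts in `ℝ³`, applied to the extensions of `f` and `g` that are constant along
rays, with a radial cut-off, and polar coordinates.
-/

noncomputable section

namespace SpacelikeTwoSphere

open MeasureTheory Metric Set

/-! ### Oriented orthonormal frames of the unit sphere -/

/-- The standard basis vectors of `ℝ³`. -/
abbrev stdVec (i : Fin 3) : E3 := EuclideanSpace.single i 1

theorem inner_eq_coord (x y : E3) : ⟪x, y⟫ = x 0 * y 0 + x 1 * y 1 + x 2 * y 2 := by
  simp [PiLp.inner_apply, Fin.sum_univ_three, mul_comm]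

theorem eq_sum_stdVec (u : E3) :
    u = u 0 • stdVec 0 + u 1 • stdVec 1 + u 2 • stdVec 2 := by
  ext i; fin_cases i <;> simp [stdVec]

theorem map_eq_sum_stdVec {V : Type*} [AddCommGroup V] [Module ℝ V] [TopologicalSpace V]
    (L : E3 →L[ℝ] V) (u : E3) :
    L u = u 0 • L (stdVec 0) + u 1 • L (stdVec 1) + u 2 • L (stdVec 2) := by
  conv_lhs => rw [eq_sum_stdVec u]
  simp only [map_add, map_smul]

/-- `u, v` is an oriented orthonormal basis of the tangent plane of the unit sphere at `p`:
the vectors `p, u, v` are orthonormal and `p = u × v`. -/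
structure IsFrame (p u v : E3) : Prop where
  pp : p 0 * p 0 + p 1 * p 1 + p 2 * p 2 = 1
  uu : u 0 * u 0 + u 1 * u 1 + u 2 * u 2 = 1
  vv : v 0 * v 0 + v 1 * v 1 + v 2 * v 2 = 1
  uv : u 0 * v 0 + u 1 * v 1 + u 2 * v 2 = 0
  pu : p 0 * u 0 + p 1 * u 1 + p 2 * u 2 = 0
  pv : p 0 * v 0 + p 1 * v 1 + p 2 * v 2 = 0
  p0 : p 0 = u 1 * v 2 - u 2 * v 1
  p1 : p 1 = u 2 * v 0 - u 0 * v 2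
  p2 : p 2 = u 0 * v 1 - u 1 * v 0

theorem IsFrame.tangent_left {p u v : E3} (h : IsFrame p u v) : IsTangent p u := by
  rw [IsTangent, inner_eq_coord, h.pu]

theorem IsFrame.tangent_right {p u v : E3} (h : IsFrame p u v) : IsTangent p v := by
  rw [IsTangent, inner_eq_coord, h.pv]

theorem sq_coord_of_mem_sphere {p : E3} (hp : p ∈ sphere (0 : E3) 1) :
    p 0 * p 0 + p 1 * p 1 + p 2 * p 2 = 1 := by
  rw [← inner_eq_coord, real_inner_self_eq_norm_sq, mem_sphere_zero_iff_norm.1 hp]; norm_num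

theorem exists_isFrame {p : E3} (hp : p ∈ sphere (0 : E3) 1) : ∃ u v : E3, IsFrame p u v := by
  have : Fact (Module.finrank ℝ E3 = 2 + 1) := ⟨by simp⟩
  have hp0 : p ≠ 0 := ne_zero_of_mem_unit_sphere ⟨p, hp⟩
  let b := OrthonormalBasis.fromOrthogonalSpanSingleton (𝕜 := ℝ) 2 hp0
  have huu : ⟪(b 0 : E3), (b 0 : E3)⟫ = 1 := (b.inner_eq_ite 0 0).trans (by simp)
  have hpu : ⟪p, (b 0 : E3)⟫ = 0 := Submodule.mem_orthogonal_singleton_iff_inner_right.1 (b 0).2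
  have hpp := sq_coord_of_mem_sphere hp
  generalize (b 0 : E3) = u at huu hpu
  rw [inner_eq_coord] at huu hpu
  refine ⟨u, !₂[p 1 * u 2 - p 2 * u 1, p 2 * u 0 - p 0 * u 2, p 0 * u 1 - p 1 * u 0], ?_⟩
  constructor <;> simp
  · linarith
  · linarith
  · linear_combination (u 0 * u 0 + u 1 * u 1 + u 2 * u 2) * hpp + huu -
      (p 0 * u 0 + p 1 * u 1 + p 2 * u 2) * hpu
  · ring
  · linarith
  · ring
  · linear_combination (-p 0) * huu + u 0 * hpu
  · linear_combination (-p 1) * huu + u 1 * hpu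
  · linear_combination (-p 2) * huu + u 2 * hpu

/-! ### Stokes' theorem on the unit sphere -/

/-- The bracket `p · (∇f × ∇g)`: on the unit sphere it is the value of the two-form `df ∧ dg`
on an oriented orthonormal frame. -/
def bracket (f g : E3 → ℝ) (p : E3) : ℝ :=
  p 0 * (fderiv ℝ f p (stdVec 1) * fderiv ℝ g p (stdVec 2)
    - fderiv ℝ f p (stdVec 2) * fderiv ℝ g p (stdVec 1))
  + p 1 * (fderiv ℝ f p (stdVec 2) * fderiv ℝ g p (stdVec 0)
    - fderiv ℝ f p (stdVec 0) * fderiv ℝ g p (stdVec 2))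
  + p 2 * (fderiv ℝ f p (stdVec 0) * fderiv ℝ g p (stdVec 1)
    - fderiv ℝ f p (stdVec 1) * fderiv ℝ g p (stdVec 0))

theorem bracket_eq_of_cross (f g : E3 → ℝ) (x u v : E3) (c : ℝ)
    (h0 : x 0 = c * (u 1 * v 2 - u 2 * v 1)) (h1 : x 1 = c * (u 2 * v 0 - u 0 * v 2))
    (h2 : x 2 = c * (u 0 * v 1 - u 1 * v 0)) :
    bracket f g x = c * (fderiv ℝ f x u * fderiv ℝ g x v - fderiv ℝ f x v * fderiv ℝ g x u) := by
  rw [map_eq_sum_stdVec (fderiv ℝ f x) u, map_eq_sum_stdVec (fderiv ℝ f x) v,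
    map_eq_sum_stdVec (fderiv ℝ g x) u, map_eq_sum_stdVec (fderiv ℝ g x) v, bracket, h0, h1, h2]
  simp only [smul_eq_mul]
  ring

theorem IsFrame.bracket_eq {p u v : E3} (h : IsFrame p u v) (f g : E3 → ℝ) :
    bracket f g p = fderiv ℝ f p u * fderiv ℝ g p v - fderiv ℝ f p v * fderiv ℝ g p u := by
  rw [bracket_eq_of_cross f g p u v 1 (by rw [h.p0, one_mul]) (by rw [h.p1, one_mul])
    (by rw [h.p2, one_mul]), one_mul]

theorem hasFDerivAt_coord (i : Fin 3) (x : E3) :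
    HasFDerivAt (fun y : E3 => y i) (EuclideanSpace.proj (𝕜 := ℝ) i : E3 →L[ℝ] ℝ) x :=
  (EuclideanSpace.proj (𝕜 := ℝ) i : E3 →L[ℝ] ℝ).hasFDerivAt

theorem contDiff_coord (i : Fin 3) {n : WithTop ℕ∞} : ContDiff ℝ n (fun y : E3 => y i) :=
  (EuclideanSpace.proj (𝕜 := ℝ) i : E3 →L[ℝ] ℝ).contDiff

theorem integral_fderiv_mul_of_compactSupport {f w : E3 → ℝ} (hf : ContDiff ℝ 1 f)
    (hw : ContDiff ℝ 1 w) (cf : HasCompactSupport f) (e : E3) :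
    Integrable (fun x => fderiv ℝ f x e * w x) ∧ Integrable (fun x => f x * fderiv ℝ w x e) ∧
    ∫ x, fderiv ℝ f x e * w x = - ∫ x, f x * fderiv ℝ w x e := by
  have cf' : HasCompactSupport (fun x => fderiv ℝ f x e) := cf.fderiv_apply ℝ e
  have kf : Continuous (fun x => fderiv ℝ f x e) :=
    (hf.continuous_fderiv one_ne_zero).clm_apply continuous_const
  have kw : Continuous (fun x => fderiv ℝ w x e) :=
    (hw.continuous_fderiv one_ne_zero).clm_apply continuous_const
  have i1 : Integrable (fun x => fderiv ℝ f x e * w x) :=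
    (kf.mul hw.continuous).integrable_of_hasCompactSupport cf'.mul_right
  have i2 : Integrable (fun x => f x * fderiv ℝ w x e) :=
    (hf.continuous.mul kw).integrable_of_hasCompactSupport cf.mul_right
  have i3 : Integrable (fun x => f x * w x) :=
    (hf.continuous.mul hw.continuous).integrable_of_hasCompactSupport cf.mul_right
  refine ⟨i1, i2, ?_⟩
  rw [integral_mul_fderiv_eq_neg_fderiv_mul_of_integrable i1 i2 i3
    (fun x _ => (hf.differentiable one_ne_zero).differentiableAt)
    (fun x _ => (hw.differentiable one_ne_zero).differentiableAt), neg_neg]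

/-- The bracket is a divergence, so its integral over `ℝ³` vanishes when `f` has compact support. -/
theorem integral_bracket_of_compactSupport {f g : E3 → ℝ} (hf : ContDiff ℝ 1 f)
    (hg : ContDiff ℝ 2 g) (cf : HasCompactSupport f) : ∫ x, bracket f g x = 0 := by
  have hD : ∀ i : Fin 3, ContDiff ℝ 1 (fun x => fderiv ℝ g x (stdVec i)) := fun i =>
    (hg.fderiv_right (m := 1) (by norm_num)).clm_apply contDiff_const
  have hW : ∀ i j : Fin 3, ContDiff ℝ 1 (fun x : E3 => x i * fderiv ℝ g x (stdVec j)
      - x j * fderiv ℝ g x (stdVec i)) := fun i j =>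
    ((contDiff_coord i).mul (hD j)).sub ((contDiff_coord j).mul (hD i))
  have hdW : ∀ (i j k : Fin 3) (x : E3), fderiv ℝ (fun x : E3 => x i * fderiv ℝ g x (stdVec j)
      - x j * fderiv ℝ g x (stdVec i)) x (stdVec k) =
      (stdVec k i * fderiv ℝ g x (stdVec j) - stdVec k j * fderiv ℝ g x (stdVec i)) +
      (x i * fderiv ℝ (fderiv ℝ g) x (stdVec k) (stdVec j)
        - x j * fderiv ℝ (fderiv ℝ g) x (stdVec k) (stdVec i)) := by
    intro i j k x
    have hd : DifferentiableAt ℝ (fderiv ℝ g) x :=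
      ((hg.fderiv_right (m := 1) (by norm_num)).differentiable one_ne_zero).differentiableAt
    have hi : ∀ i : Fin 3, HasFDerivAt (fun x => fderiv ℝ g x (stdVec i))
        ((fderiv ℝ (fderiv ℝ g) x).flip (stdVec i)) x := fun i => by
      simpa using hd.hasFDerivAt.clm_apply (hasFDerivAt_const (stdVec i) x)
    have h := (((hasFDerivAt_coord i x).mul (hi j)).sub ((hasFDerivAt_coord j x).mul (hi i))).fderiv
    refine (congrArg (fun L : E3 →L[ℝ] ℝ => L (stdVec k)) h).trans ?_
    simp
    ring
  have hsymm : ∀ (x a b : E3), fderiv ℝ (fderiv ℝ g) x a b = fderiv ℝ (fderiv ℝ g) x b a :=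
    fun x a b => hg.contDiffAt.isSymmSndFDerivAt (by simp) a b
  obtain ⟨a0, b0, c0⟩ := integral_fderiv_mul_of_compactSupport hf (hW 2 1) cf (stdVec 0)
  obtain ⟨a1, b1, c1⟩ := integral_fderiv_mul_of_compactSupport hf (hW 0 2) cf (stdVec 1)
  obtain ⟨a2, b2, c2⟩ := integral_fderiv_mul_of_compactSupport hf (hW 1 0) cf (stdVec 2)
  have e : bracket f g = fun x => fderiv ℝ f x (stdVec 0) * (x 2 * fderiv ℝ g x (stdVec 1)
      - x 1 * fderiv ℝ g x (stdVec 2)) + fderiv ℝ f x (stdVec 1) * (x 0 * fderiv ℝ g x (stdVec 2)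
      - x 2 * fderiv ℝ g x (stdVec 0)) + fderiv ℝ f x (stdVec 2) * (x 1 * fderiv ℝ g x (stdVec 0)
      - x 0 * fderiv ℝ g x (stdVec 1)) := by
    funext x; simp only [bracket]; ring
  have e1 := integral_add (a0.add a1) a2
  have e2 := integral_add (b0.add b1) b2
  simp only [Pi.add_apply] at e1 e2
  rw [e, e1, integral_add a0 a1, c0, c1, c2, ← neg_add, ← neg_add, ← integral_add b0 b1, ← e2]
  rw [neg_eq_zero, ← integral_zero E3 ℝ]
  congr 1
  funext x
  simp only [hdW]
  rw [hsymm x (stdVec 1) (stdVec 0), hsymm x (stdVec 2) (stdVec 0), hsymm x (stdVec 2) (stdVec 1)]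
  simp [stdVec]
  ring

/-- The radial retraction of `ℝ³ ∖ {0}` to the unit sphere. -/
def retract (x : E3) : E3 := (Real.sqrt (‖x‖ ^ 2))⁻¹ • x

theorem retract_eq (x : E3) : retract x = ‖x‖⁻¹ • x := by
  rw [retract, Real.sqrt_sq (norm_nonneg x)]

theorem retract_mem {x : E3} (hx : x ≠ 0) : retract x ∈ sphere (0 : E3) 1 := by
  rw [retract_eq, mem_sphere_zero_iff_norm, norm_smul, norm_inv, norm_norm,
    inv_mul_cancel₀ (norm_ne_zero_iff.2 hx)]

theorem retract_of_mem {p : E3} (hp : p ∈ sphere (0 : E3) 1) : retract p = p := by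
  rw [retract_eq, mem_sphere_zero_iff_norm.1 hp, inv_one, one_smul]

theorem contDiffAt_retract {x : E3} (hx : x ≠ 0) : ContDiffAt ℝ ∞ retract x := by
  have : ‖x‖ ^ 2 ≠ 0 := pow_ne_zero 2 (norm_ne_zero_iff.2 hx)
  exact (((contDiff_norm_sq ℝ).contDiffAt.sqrt this).inv (by
    rw [Real.sqrt_sq (norm_nonneg x)]; exact norm_ne_zero_iff.2 hx)).smul contDiffAt_id

theorem fderiv_norm_sq_eq_zero {x u : E3} (hu : IsTangent x u) :
    fderiv ℝ (fun y : E3 => ‖y‖ ^ 2) x u = 0 := by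
  rw [(hasStrictFDerivAt_norm_sq x).hasFDerivAt.fderiv]
  simpa using (show ⟪x, u⟫ = 0 from hu)

theorem fderiv_retract {x u : E3} (hx : x ≠ 0) (hu : IsTangent x u) :
    fderiv ℝ retract x u = ‖x‖⁻¹ • u := by
  have h2 : ‖x‖ ^ 2 ≠ 0 := pow_ne_zero 2 (norm_ne_zero_iff.2 hx)
  have hs : Real.sqrt (‖x‖ ^ 2) ≠ 0 := by
    rw [Real.sqrt_sq (norm_nonneg x)]; exact norm_ne_zero_iff.2 hx
  have h := ((hasDerivAt_inv hs).comp_hasFDerivAt x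
    ((hasStrictFDerivAt_norm_sq x).hasFDerivAt.sqrt h2)).smul (hasFDerivAt_id x)
  refine (congrArg (fun L : E3 →L[ℝ] E3 => L u) h.fderiv).trans ?_
  have : ⟪x, u⟫ = 0 := hu
  simp [this, Real.sqrt_sq (norm_nonneg x)]

/-- The tangential derivative of a map at a point of the unit sphere depends only on the
restriction of the map to the sphere. -/
theorem fderiv_congr_of_eqOn_sphere {V : Type*} [NormedAddCommGroup V] [NormedSpace ℝ V]
    {f g : E3 → V} (h : EqOn f g (sphere (0 : E3) 1)) {p v : E3} (hp : p ∈ sphere (0 : E3) 1)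
    (hf : DifferentiableAt ℝ f p) (hg : DifferentiableAt ℝ g p) (hv : IsTangent p v) :
    fderiv ℝ f p v = fderiv ℝ g p v := by
  have hp0 : p ≠ 0 := ne_zero_of_mem_unit_sphere ⟨p, hp⟩
  have hr : DifferentiableAt ℝ retract p := (contDiffAt_retract hp0).differentiableAt (by simp)
  have key : ∀ k : E3 → V, DifferentiableAt ℝ k p →
      fderiv ℝ (k ∘ retract) p v = fderiv ℝ k p v := by
    intro k hk
    rw [fderiv_comp p (by rwa [retract_of_mem hp]) hr, ContinuousLinearMap.comp_apply,
      fderiv_retract hp0 hv, retract_of_mem hp, mem_sphere_zero_iff_norm.1 hp, inv_one, one_smul]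
  rw [← key f hf, ← key g hg]
  have : f ∘ retract =ᶠ[nhds p] g ∘ retract := by
    filter_upwards [isOpen_ne.mem_nhds hp0] with x hx using h (retract_mem hx)
  rw [this.fderiv_eq]

/-- A smooth function with compact support in `(1, 3)`, equal to `1` around `2`. -/
def radialBump : ContDiffBump (2 : ℝ) := ⟨1 / 2, 1, by norm_num, by norm_num⟩

theorem radialBump_two : radialBump 2 = 1 :=
  radialBump.one_of_mem_closedBall (by simp [radialBump.rIn_pos.le])

theorem radialBump_of_le {s : ℝ} (h : s ≤ 1) : radialBump s = 0 :=
  radialBump.zero_of_le_dist (by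
    rw [Real.dist_eq, abs_of_neg (by linarith)]; simp [radialBump]; linarith)

theorem radialBump_of_ge {s : ℝ} (h : 3 ≤ s) : radialBump s = 0 :=
  radialBump.zero_of_le_dist (by
    rw [Real.dist_eq, abs_of_pos (by linarith)]; simp [radialBump]; linarith)

/-- The extension of a function from the unit sphere to `ℝ³`, constant along rays, cut off
radially near the origin and near infinity. -/
def cutExtend (f : E3 → ℝ) (x : E3) : ℝ := radialBump (‖x‖ ^ 2) * f (retract x)

theorem cutExtend_of_lt {f : E3 → ℝ} {x : E3} (hx : ‖x‖ < 1) : cutExtend f x = 0 := by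
  rw [cutExtend, radialBump_of_le (by nlinarith [norm_nonneg x]), zero_mul]

theorem contDiff_cutExtend {f : E3 → ℝ} (hf : ∀ p ∈ sphere (0 : E3) 1, ContDiffAt ℝ ∞ f p) :
    ContDiff ℝ ∞ (cutExtend f) := by
  rw [contDiff_iff_contDiffAt]
  intro x
  rcases eq_or_ne x 0 with rfl | hx
  · have : cutExtend f =ᶠ[nhds 0] fun _ => 0 := by
      filter_upwards [ball_mem_nhds (0 : E3) one_pos] with y hy
      exact cutExtend_of_lt (by simpa using hy)
    exact contDiffAt_const.congr_of_eventuallyEq this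
  · exact (radialBump.contDiffAt.comp x (contDiff_norm_sq ℝ).contDiffAt).mul
      ((hf _ (retract_mem hx)).comp x (contDiffAt_retract hx))

theorem hasCompactSupport_cutExtend (f : E3 → ℝ) : HasCompactSupport (cutExtend f) := by
  refine HasCompactSupport.of_support_subset_isCompact (isCompact_closedBall (0 : E3) 2) ?_
  intro x hx
  by_contra h
  rw [mem_closedBall_zero_iff, not_le] at h
  exact hx (by rw [cutExtend, radialBump_of_ge (by nlinarith), zero_mul])

theorem fderiv_cutExtend {f : E3 → ℝ} (hf : ∀ p ∈ sphere (0 : E3) 1, ContDiffAt ℝ ∞ f p)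
    {x u : E3} (hx : x ≠ 0) (hu : IsTangent x u) :
    fderiv ℝ (cutExtend f) x u =
      radialBump (‖x‖ ^ 2) * ‖x‖⁻¹ * fderiv ℝ f (retract x) u := by
  have h1 : DifferentiableAt ℝ (fun y : E3 => radialBump (‖y‖ ^ 2)) x :=
    (radialBump.contDiffAt.comp x (contDiff_norm_sq ℝ (n := 1)).contDiffAt).differentiableAt
      one_ne_zero
  have hr : DifferentiableAt ℝ retract x := (contDiffAt_retract hx).differentiableAt (by simp)
  have hf' : DifferentiableAt ℝ f (retract x) :=
    (hf _ (retract_mem hx)).differentiableAt (by simp)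
  have h2 : DifferentiableAt ℝ (f ∘ retract) x := hf'.comp x hr
  have e : fderiv ℝ (fun y : E3 => radialBump (‖y‖ ^ 2)) x u = 0 := by
    have := fderiv_comp x (g := radialBump) (f := fun y : E3 => ‖y‖ ^ 2)
      (radialBump.contDiff.differentiable (n := 1) one_ne_zero).differentiableAt
      ((contDiff_norm_sq ℝ (n := 1)).differentiable one_ne_zero).differentiableAt
    rw [Function.comp_def] at this
    rw [this, ContinuousLinearMap.comp_apply, fderiv_norm_sq_eq_zero hu, map_zero]
  rw [show cutExtend f = fun y => radialBump (‖y‖ ^ 2) * (f ∘ retract) y from rfl,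
    fderiv_fun_mul h1 h2]
  simp only [add_apply, smul_apply, smul_eq_mul, e,
    mul_zero, add_zero]
  rw [fderiv_comp x hf' hr, ContinuousLinearMap.comp_apply, fderiv_retract hx hu, map_smul,
    smul_eq_mul]
  ring

/-- A radial factor differentiates to zero in tangential directions, so the bracket of the extended
functions is a product of the bracket on the sphere with a function of the radius. -/
theorem bracket_cutExtend {f g : E3 → ℝ} (hf : ∀ p ∈ sphere (0 : E3) 1, ContDiffAt ℝ ∞ f p)
    (hg : ∀ p ∈ sphere (0 : E3) 1, ContDiffAt ℝ ∞ g p) {x : E3} (hx : x ≠ 0) :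
    bracket (cutExtend f) (cutExtend g) x =
      bracket f g (‖x‖⁻¹ • x) * (radialBump (‖x‖ ^ 2) ^ 2 * ‖x‖⁻¹) := by
  obtain ⟨u, v, h⟩ := exists_isFrame (retract_mem hx)
  have hn : ‖x‖ ≠ 0 := norm_ne_zero_iff.2 hx
  have hxp : ∀ i, x i = ‖x‖ * retract x i := fun i => by
    rw [retract_eq]; simp [hn]
  have ht : ∀ w, IsTangent (retract x) w → IsTangent x w := fun w hw => by
    have hw' : ⟪‖x‖⁻¹ • x, w⟫ = 0 := by rw [← retract_eq]; exact hw
    rw [real_inner_smul_left] at hw'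
    exact (mul_eq_zero.1 hw').resolve_left (inv_ne_zero hn)
  rw [bracket_eq_of_cross _ _ x u v ‖x‖ (by rw [hxp, h.p0]) (by rw [hxp, h.p1])
    (by rw [hxp, h.p2]), ← retract_eq, h.bracket_eq, fderiv_cutExtend hf hx (ht u h.tangent_left),
    fderiv_cutExtend hf hx (ht v h.tangent_right), fderiv_cutExtend hg hx (ht u h.tangent_left),
    fderiv_cutExtend hg hx (ht v h.tangent_right)]
  field_simp

/-- Polar coordinates in `ℝ³` for a product of a function of the direction and one of the radius. -/
theorem integral_sphere_mul_radial (b : E3 → ℝ) (c : ℝ → ℝ) :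
    ∫ x : E3, b (‖x‖⁻¹ • x) * c ‖x‖ =
      (∫ p : sphere (0 : E3) 1, b p ∂(volume : Measure E3).toSphere) *
        ∫ r : Ioi (0 : ℝ), c r ∂Measure.volumeIoiPow (Module.finrank ℝ E3 - 1) := by
  calc ∫ x : E3, b (‖x‖⁻¹ • x) * c ‖x‖
      = ∫ x : ({(0)}ᶜ : Set E3), b (‖x.1‖⁻¹ • x.1) * c ‖x.1‖
          ∂((volume : Measure E3).comap (↑)) := by
        rw [integral_subtype_comap (measurableSet_singleton _).compl
          fun x : E3 => b (‖x‖⁻¹ • x) * c ‖x‖, restrict_compl_singleton]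
    _ = ∫ x : sphere (0 : E3) 1 × Ioi (0 : ℝ), b x.1 * c x.2
          ∂(volume : Measure E3).toSphere.prod (.volumeIoiPow (Module.finrank ℝ E3 - 1)) := by
        simpa using (volume : Measure E3).measurePreserving_homeomorphUnitSphereProd.integral_comp
          (Homeomorph.measurableEmbedding _)
          (fun x : sphere (0 : E3) 1 × Ioi (0 : ℝ) => b x.1 * c x.2)
    _ = _ := integral_prod_mul (fun p : sphere (0 : E3) 1 => b p) (fun r : Ioi (0 : ℝ) => c r)

/-- **Stokes' theorem** on the unit sphere, for the exact two-form `df ∧ dg = d (f dg)`. -/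
theorem integral_bracket_sphere {f g : E3 → ℝ}
    (hf : ∀ p ∈ sphere (0 : E3) 1, ContDiffAt ℝ ∞ f p)
    (hg : ∀ p ∈ sphere (0 : E3) 1, ContDiffAt ℝ ∞ g p) :
    ∫ p : sphere (0 : E3) 1, bracket f g p ∂(volume : Measure E3).toSphere = 0 := by
  have h0 := integral_bracket_of_compactSupport ((contDiff_cutExtend hf).of_le (by simp))
    (contDiff_infty.1 (contDiff_cutExtend hg) 2) (hasCompactSupport_cutExtend f)
  have h1 : ∫ x, bracket (cutExtend f) (cutExtend g) x =
      ∫ x : E3, bracket f g (‖x‖⁻¹ • x) * (radialBump (‖x‖ ^ 2) ^ 2 * ‖x‖⁻¹) := by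
    refine integral_congr_ae ?_
    filter_upwards [compl_mem_ae_iff.2 (measure_singleton (0 : E3))] with x hx
    exact bracket_cutExtend hf hg hx
  rw [h0, integral_sphere_mul_radial (bracket f g)
    (fun r => radialBump (r ^ 2) ^ 2 * r⁻¹)] at h1
  -- the radial factor is positive, as one sees by comparing with the constant function `1`
  refine (mul_eq_zero.1 h1.symm).resolve_right fun hz => ?_
  have h2 := integral_sphere_mul_radial (fun _ => 1) (fun r => radialBump (r ^ 2) ^ 2 * r⁻¹)
  rw [hz, mul_zero] at h2
  refine h2.not_gt ?_
  have hc : Continuous fun x : E3 => (1 : ℝ) * (radialBump (‖x‖ ^ 2) ^ 2 * ‖x‖⁻¹) := by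
    rw [continuous_iff_continuousAt]
    intro x
    rcases eq_or_ne x 0 with rfl | hx
    · have : (fun x : E3 => (1 : ℝ) * (radialBump (‖x‖ ^ 2) ^ 2 * ‖x‖⁻¹)) =ᶠ[nhds 0]
          fun _ => 0 := by
        filter_upwards [ball_mem_nhds (0 : E3) one_pos] with y hy
        have hy : ‖y‖ < 1 := by simpa using hy
        rw [radialBump_of_le (by nlinarith [norm_nonneg y])]; simp
      exact continuousAt_const.congr this.symm
    · exact continuousAt_const.mul
        (((radialBump.continuous.comp (continuous_norm.pow 2)).pow 2).continuousAt.mul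
          (continuous_norm.continuousAt.inv₀ (norm_ne_zero_iff.2 hx)))
  refine hc.integral_pos_of_hasCompactSupport_nonneg_nonzero (x := Real.sqrt 2 • stdVec 0) ?_ ?_ ?_
  · refine HasCompactSupport.of_support_subset_isCompact (isCompact_closedBall (0 : E3) 2) ?_
    intro x hx
    by_contra h
    rw [mem_closedBall_zero_iff, not_le] at h
    exact hx (by simp only; rw [radialBump_of_ge (by nlinarith)]; simp)
  · intro x
    have : 0 ≤ ‖x‖⁻¹ := by positivity
    simp only [Pi.zero_apply]
    positivity
  · have : ‖Real.sqrt 2 • stdVec 0‖ = Real.sqrt 2 := by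
      simp [norm_smul, abs_of_nonneg (Real.sqrt_nonneg 2)]
    rw [this, Real.sq_sqrt (by norm_num), radialBump_two]
    simp

theorem integral_one_sphere :
    ∫ _ : sphere (0 : E3) 1, (1 : ℝ) ∂(volume : Measure E3).toSphere = 4 * Real.pi := by
  rw [integral_const, Measure.toSphere_real_apply_univ, measureReal_def,
    EuclideanSpace.volume_ball_fin_three]
  simp [ENNReal.toReal_ofReal (by positivity : (0 : ℝ) ≤ Real.pi * 4 / 3)]
  ring

theorem continuous_sphere_of_contDiffAt {V : Type*} [NormedAddCommGroup V] [NormedSpace ℝ V]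
    {f : E3 → V} (hf : ∀ p ∈ sphere (0 : E3) 1, ContDiffAt ℝ ∞ f p) :
    Continuous fun p : sphere (0 : E3) 1 => f p :=
  continuous_iff_continuousAt.2 fun p =>
    ContinuousAt.comp (g := f) (hf p p.2).continuousAt continuous_subtype_val.continuousAt

theorem continuous_bracket_sphere {f g : E3 → ℝ}
    (hf : ∀ p ∈ sphere (0 : E3) 1, ContDiffAt ℝ ∞ f p)
    (hg : ∀ p ∈ sphere (0 : E3) 1, ContDiffAt ℝ ∞ g p) :
    Continuous fun p : sphere (0 : E3) 1 => bracket f g p := by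
  have h : ∀ k : E3 → ℝ, (∀ p ∈ sphere (0 : E3) 1, ContDiffAt ℝ ∞ k p) → ∀ i,
      Continuous fun p : sphere (0 : E3) 1 => fderiv ℝ k p (stdVec i) := fun k hk i =>
    continuous_sphere_of_contDiffAt (f := fun p => fderiv ℝ k p (stdVec i)) fun p hp =>
      ((hk p hp).fderiv_right (m := ∞) (by simp)).clm_apply contDiffAt_const
  have hi : ∀ i : Fin 3, Continuous fun p : sphere (0 : E3) 1 => (p : E3) i := fun i =>
    (EuclideanSpace.proj (𝕜 := ℝ) i : E3 →L[ℝ] ℝ).continuous.comp continuous_subtype_val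
  have f0 := h f hf 0
  have f1 := h f hf 1
  have f2 := h f hf 2
  have g0 := h g hg 0
  have g1 := h g hg 1
  have g2 := h g hg 2
  have i0 := hi 0
  have i1 := hi 1
  have i2 := hi 2
  unfold bracket
  fun_prop

theorem integrable_bracket_sphere {f g : E3 → ℝ}
    (hf : ∀ p ∈ sphere (0 : E3) 1, ContDiffAt ℝ ∞ f p)
    (hg : ∀ p ∈ sphere (0 : E3) 1, ContDiffAt ℝ ∞ g p) :
    Integrable (fun p : sphere (0 : E3) 1 => bracket f g p) (volume : Measure E3).toSphere :=
  (continuous_bracket_sphere hf hg).integrable_of_hasCompactSupport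
    (HasCompactSupport.of_compactSpace _)

/-! ### The Minkowski form and its exterior calculus on the sphere -/

section Eta

variable {R : Type*} [CommRing R]

theorem eta_comm (x y : Fin 4 → R) : eta x y = eta y x := by simp only [eta]; ring

theorem eta_add_left (x y z : Fin 4 → R) : eta (x + y) z = eta x z + eta y z := by
  simp only [eta, Pi.add_apply]; ring

theorem eta_add_right (x y z : Fin 4 → R) : eta x (y + z) = eta x y + eta x z := by
  simp only [eta, Pi.add_apply]; ring

theorem eta_sub_left (x y z : Fin 4 → R) : eta (x - y) z = eta x z - eta y z := by
  simp only [eta, Pi.sub_apply]; ring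

theorem eta_sub_right (x y z : Fin 4 → R) : eta x (y - z) = eta x y - eta x z := by
  simp only [eta, Pi.sub_apply]; ring

theorem eta_smul_left (c : R) (x y : Fin 4 → R) : eta (c • x) y = c * eta x y := by
  simp only [eta, Pi.smul_apply, smul_eq_mul]; ring

theorem eta_smul_right (c : R) (x y : Fin 4 → R) : eta x (c • y) = c * eta x y := by
  simp only [eta, Pi.smul_apply, smul_eq_mul]; ring

theorem eta_neg_right (x y : Fin 4 → R) : eta x (-y) = -eta x y := by
  simp only [eta, Pi.neg_apply]; ring

theorem eta_zero_left (x : Fin 4 → R) : eta 0 x = 0 := by simp [eta]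

end Eta

/-- Completeness of a null frame: `η` is recovered from the components along a pair of null vectors
`l, n` with `η(l, n) = 1` and two orthonormal space-like vectors orthogonal to both. -/
theorem eta_eq_of_null_frame {l n f g : Mink} (ll : eta l l = 0) (nn : eta n n = 0)
    (ln : eta l n = 1) (lf : eta l f = 0) (lg : eta l g = 0) (nf : eta n f = 0) (ng : eta n g = 0)
    (ff : eta f f = -1) (gg : eta g g = -1) (fg : eta f g = 0) (x y : Mink) :
    eta x y = eta x l * eta y n + eta x n * eta y l - eta x f * eta y f - eta x g * eta y g := by
  -- `B H Bᵀ = G` with `H² = G² = 1` gives `Bᵀ G B = H`, which is the claim in coordinates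
  let H : Matrix (Fin 4) (Fin 4) ℝ := Matrix.diagonal ![1, -1, -1, -1]
  let B : Matrix (Fin 4) (Fin 4) ℝ := Matrix.of ![l, n, f, g]
  let G : Matrix (Fin 4) (Fin 4) ℝ := !![0, 1, 0, 0; 1, 0, 0, 0; 0, 0, -1, 0; 0, 0, 0, -1]
  have nl : eta n l = 1 := by rw [eta_comm, ln]
  have fl : eta f l = 0 := by rw [eta_comm, lf]
  have gl : eta g l = 0 := by rw [eta_comm, lg]
  have fn : eta f n = 0 := by rw [eta_comm, nf]
  have gn : eta g n = 0 := by rw [eta_comm, ng]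
  have gf : eta g f = 0 := by rw [eta_comm, fg]
  have hBHB : B * H * B.transpose = G := by
    have key : ∀ i j, (B * H * B.transpose) i j = eta (B i) (B j) := by
      intro i j
      simp [Matrix.mul_apply, H, Matrix.diagonal_apply, Fin.sum_univ_four, eta]
      ring
    ext i j
    rw [key]
    change eta (![l, n, f, g] i) (![l, n, f, g] j) = _
    fin_cases i <;> fin_cases j <;> simp [G, *]
  have hG : G * G = 1 := by
    ext i j; fin_cases i <;> fin_cases j <;> simp [G, Matrix.mul_apply, Fin.sum_univ_four]
  have hH : H * H = 1 := by
    ext i j; fin_cases i <;> fin_cases j <;>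
      simp [H, Matrix.mul_apply, Matrix.diagonal_apply]
  have h1 : (B * H) * (B.transpose * G) = 1 := by
    rw [← mul_assoc, hBHB, hG]
  have h2 : B.transpose * G * B = H := by
    have h3 : (B.transpose * G) * (B * H) = 1 := mul_eq_one_comm.1 h1
    calc B.transpose * G * B = (B.transpose * G * (B * H)) * H := by
          rw [mul_assoc, mul_assoc, mul_assoc B H H, hH, mul_one, ← mul_assoc]
      _ = H := by rw [h3, one_mul]
  have h4 : ∀ a b : Fin 4, l a * n b + n a * l b - f a * f b - g a * g b = H a b := by
    intro a b
    rw [← h2]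
    simp [Matrix.mul_apply, B, G, Fin.sum_univ_four]
    ring
  have h5 : eta x l * eta y n + eta x n * eta y l - eta x f * eta y f - eta x g * eta y g
      = eta x (fun a => eta y (fun b => l a * n b + n a * l b - f a * f b - g a * g b)) := by
    simp only [eta]; ring
  rw [h5]
  simp only [h4]
  simp [eta, H]

theorem fderiv_component {A : E3 → Mink} {p : E3} (hA : DifferentiableAt ℝ A p) (a : Fin 4)
    (w : E3) : fderiv ℝ (fun x => A x a) p w = fderiv ℝ A p w a := by
  have := (hasFDerivAt_pi'.1 hA.hasFDerivAt a).fderiv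
  rw [this]; rfl

theorem contDiffAt_component {A : E3 → Mink} {p : E3} {n : WithTop ℕ∞} (hA : ContDiffAt ℝ n A p)
    (a : Fin 4) : ContDiffAt ℝ n (fun x => A x a) p :=
  contDiffAt_pi.1 hA a

theorem contDiffAt_eta {A B : E3 → Mink} {p : E3} {n : WithTop ℕ∞} (hA : ContDiffAt ℝ n A p)
    (hB : ContDiffAt ℝ n B p) : ContDiffAt ℝ n (fun x => eta (A x) (B x)) p := by
  unfold eta
  exact ((((contDiffAt_component hA 0).mul (contDiffAt_component hB 0)).sub
    ((contDiffAt_component hA 1).mul (contDiffAt_component hB 1))).sub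
    ((contDiffAt_component hA 2).mul (contDiffAt_component hB 2))).sub
    ((contDiffAt_component hA 3).mul (contDiffAt_component hB 3))

theorem fderiv_eta {A B : E3 → Mink} {p : E3} (hA : DifferentiableAt ℝ A p)
    (hB : DifferentiableAt ℝ B p) (w : E3) :
    fderiv ℝ (fun x => eta (A x) (B x)) p w =
      eta (fderiv ℝ A p w) (B p) + eta (A p) (fderiv ℝ B p w) := by
  have h : ∀ a, HasFDerivAt (fun x => A x a * B x a)
      (A p a • fderiv ℝ (fun x => B x a) p + B p a • fderiv ℝ (fun x => A x a) p) p := fun a =>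
    (differentiableAt_pi.1 hA a).hasFDerivAt.mul (differentiableAt_pi.1 hB a).hasFDerivAt
  have := ((((h 0).sub (h 1)).sub (h 2)).sub (h 3)).fderiv
  refine (congrArg (fun L : E3 →L[ℝ] ℝ => L w) this).trans ?_
  simp only [sub_apply, add_apply, smul_apply, smul_eq_mul, fderiv_component hA,
    fderiv_component hB, eta]
  ring

theorem eta_fderiv_of_eqOn_const {A B : E3 → Mink} {c : ℝ} {p w : E3}
    (hp : p ∈ sphere (0 : E3) 1) (hA : ContDiffAt ℝ ∞ A p) (hB : ContDiffAt ℝ ∞ B p)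
    (h : ∀ x ∈ sphere (0 : E3) 1, eta (A x) (B x) = c) (hw : IsTangent p w) :
    eta (fderiv ℝ A p w) (B p) + eta (A p) (fderiv ℝ B p w) = 0 := by
  have h' := fderiv_congr_of_eqOn_sphere (f := fun x => eta (A x) (B x)) (g := fun _ => c) h hp
    ((contDiffAt_eta hA hB).differentiableAt (by simp)) (differentiableAt_const c) hw
  rw [fderiv_eta (hA.differentiableAt (by simp)) (hB.differentiableAt (by simp))] at h'
  simpa using h'

/-- The two-form `η_ab dA^a ∧ dB^b` on the unit sphere, evaluated on an oriented orthonormal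
frame. -/
def etaBracket (A B : E3 → Mink) (p : E3) : ℝ :=
  bracket (fun x => A x 0) (fun x => B x 0) p - bracket (fun x => A x 1) (fun x => B x 1) p
    - bracket (fun x => A x 2) (fun x => B x 2) p - bracket (fun x => A x 3) (fun x => B x 3) p

theorem IsFrame.etaBracket_eq {p u v : E3} (h : IsFrame p u v) {A B : E3 → Mink}
    (hA : DifferentiableAt ℝ A p) (hB : DifferentiableAt ℝ B p) :
    etaBracket A B p =
      eta (fderiv ℝ A p u) (fderiv ℝ B p v) - eta (fderiv ℝ A p v) (fderiv ℝ B p u) := by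
  simp only [etaBracket, h.bracket_eq, fderiv_component hA, fderiv_component hB, eta]
  ring

theorem integrable_etaBracket {A B : E3 → Mink}
    (hA : ∀ p ∈ sphere (0 : E3) 1, ContDiffAt ℝ ∞ A p)
    (hB : ∀ p ∈ sphere (0 : E3) 1, ContDiffAt ℝ ∞ B p) :
    Integrable (fun p : sphere (0 : E3) 1 => etaBracket A B p) (volume : Measure E3).toSphere := by
  have h : ∀ a, Integrable (fun p : sphere (0 : E3) 1 =>
      bracket (fun x => A x a) (fun x => B x a) p) (volume : Measure E3).toSphere := fun a =>
    integrable_bracket_sphere (fun p hp => contDiffAt_component (hA p hp) a)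
      (fun p hp => contDiffAt_component (hB p hp) a)
  exact (((h 0).sub (h 1)).sub (h 2)).sub (h 3)

theorem integral_etaBracket {A B : E3 → Mink}
    (hA : ∀ p ∈ sphere (0 : E3) 1, ContDiffAt ℝ ∞ A p)
    (hB : ∀ p ∈ sphere (0 : E3) 1, ContDiffAt ℝ ∞ B p) :
    ∫ p : sphere (0 : E3) 1, etaBracket A B p ∂(volume : Measure E3).toSphere = 0 := by
  have h : ∀ a, Integrable (fun p : sphere (0 : E3) 1 =>
      bracket (fun x => A x a) (fun x => B x a) p) (volume : Measure E3).toSphere := fun a =>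
    integrable_bracket_sphere (fun p hp => contDiffAt_component (hA p hp) a)
      (fun p hp => contDiffAt_component (hB p hp) a)
  have h0 : ∀ a, ∫ p : sphere (0 : E3) 1, bracket (fun x => A x a) (fun x => B x a) p
      ∂(volume : Measure E3).toSphere = 0 := fun a =>
    integral_bracket_sphere (fun p hp => contDiffAt_component (hA p hp) a)
      (fun p hp => contDiffAt_component (hB p hp) a)
  have e3 := integral_sub (((h 0).sub (h 1)).sub (h 2)) (h 3)
  have e2 := integral_sub ((h 0).sub (h 1)) (h 2)
  have e1 := integral_sub (h 0) (h 1)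
  simp only [Pi.sub_apply] at e1 e2 e3
  unfold etaBracket
  rw [e3, e2, e1, h0, h0, h0, h0]
  norm_num

/-! ### Gauss–Bonnet for plane bundles isometric to the tangent bundle -/

/-- The polarized `2 × 2` determinant of the two bilinear forms with values `η(·, lᵢ)` and
`η(·, nᵢ)` on the vectors `a, b`. For `n = l` it is twice the determinant. -/
def mixedDet (a b l₁ l₂ n₁ n₂ : Mink) : ℝ :=
  eta a l₁ * eta b n₂ + eta a n₁ * eta b l₂ - eta b l₁ * eta a n₂ - eta b n₁ * eta a l₂

/-- The linear map `ℝ³ → ℝ⁴` with columns `F 0 p`, `F 1 p`, `F 2 p`. -/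
def columns (F : Fin 3 → E3 → Mink) (p z : E3) : Mink := z 0 • F 0 p + z 1 • F 1 p + z 2 • F 2 p

/-- The derivative of `columns F` in the direction `w`, applied to a fixed `z`. -/
def columnsDeriv (F : Fin 3 → E3 → Mink) (p w z : E3) : Mink :=
  z 0 • fderiv ℝ (F 0) p w + z 1 • fderiv ℝ (F 1) p w + z 2 • fderiv ℝ (F 2) p w

/-- Three fields that form the columns of an isometric embedding of the tangent bundle of the unit
sphere into the trivial bundle with fibre Minkowski space: at each `p`, `columns F p` kills `p` and
maps the tangent plane isometrically onto a space-like plane (the sign is due to the signature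
`(+,-,-,-)`). -/
structure IsTangentIsometry (F : Fin 3 → E3 → Mink) : Prop where
  smooth : ∀ k, ∀ p ∈ sphere (0 : E3) 1, ContDiffAt ℝ ∞ (F k) p
  radial : ∀ p ∈ sphere (0 : E3) 1, columns F p p = 0
  inner : ∀ p ∈ sphere (0 : E3) 1, ∀ j k, eta (F j p) (F k p) = p j * p k - if j = k then 1 else 0

namespace IsTangentIsometry

variable {F : Fin 3 → E3 → Mink} (hF : IsTangentIsometry F) {p : E3}
  (hp : p ∈ sphere (0 : E3) 1)

include hF hp

theorem differentiableAt (k : Fin 3) : DifferentiableAt ℝ (F k) p :=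
  (hF.smooth k p hp).differentiableAt (by simp)

/-- Differentiating `∑ x_k F_k = 0` along the sphere. -/
theorem columnsDeriv_radial {w : E3} (hw : IsTangent p w) :
    columnsDeriv F p w p = -columns F p w := by
  have hd : ∀ k, HasFDerivAt (fun x : E3 => x k • F k x) _ p := fun k =>
    (hasFDerivAt_coord k p).smul (hF.differentiableAt hp k).hasFDerivAt
  have h := ((hd 0).add (hd 1)).add (hd 2)
  have h1 := fderiv_congr_of_eqOn_sphere (g := fun _ => 0) hF.radial hp h.differentiableAt
    (differentiableAt_const 0) hw
  have h2 := congrArg (fun L : E3 →L[ℝ] Mink => L w) h.fderiv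
  have h3 := h2.symm.trans h1
  simp at h3
  rw [eq_neg_iff_add_eq_zero, ← h3, columnsDeriv, columns]
  abel

theorem eta_columns (z w : E3) : eta (columns F p z) (columns F p w) =
    (p 0 * z 0 + p 1 * z 1 + p 2 * z 2) * (p 0 * w 0 + p 1 * w 1 + p 2 * w 2)
      - (z 0 * w 0 + z 1 * w 1 + z 2 * w 2) := by
  simp only [columns, eta_add_left, eta_add_right, eta_smul_left, eta_smul_right, hF.inner p hp]
  simp
  ring

theorem eta_deriv {w : E3} (hw : IsTangent p w) (j k : Fin 3) :
    eta (fderiv ℝ (F j) p w) (F k p) + eta (F j p) (fderiv ℝ (F k) p w) =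
      w j * p k + p j * w k := by
  have h := fderiv_congr_of_eqOn_sphere (f := fun x => eta (F j x) (F k x))
    (g := fun x => x j * x k - if j = k then 1 else 0) (fun x hx => hF.inner x hx j k) hp
    ((contDiffAt_eta (hF.smooth j p hp) (hF.smooth k p hp)).differentiableAt (by simp))
    ((((contDiff_coord j).mul (contDiff_coord k)).sub contDiff_const).differentiable
      (n := 1) one_ne_zero).differentiableAt hw
  rw [fderiv_eta (hF.differentiableAt hp j) (hF.differentiableAt hp k)] at h
  rw [h]
  have h' := (((hasFDerivAt_coord j p).mul (hasFDerivAt_coord k p)).sub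
    (hasFDerivAt_const (if j = k then (1 : ℝ) else 0) p)).fderiv
  refine (congrArg (fun L : E3 →L[ℝ] ℝ => L w) h').trans ?_
  simp
  ring

/-- The connection form is antisymmetric because `F` is isometric. -/
theorem eta_columns_columnsDeriv {w : E3} (hw : IsTangent p w) {y z : E3} (hy : IsTangent p y)
    (hz : IsTangent p z) :
    eta (columns F p y) (columnsDeriv F p w z) + eta (columns F p z) (columnsDeriv F p w y)
      = 0 := by
  have e := fun j k => hF.eta_deriv hp hw j k
  rw [IsTangent, inner_eq_coord] at hy hz
  have c : ∀ j k, eta (fderiv ℝ (F j) p w) (F k p) = w j * p k + p j * w k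
      - eta (F j p) (fderiv ℝ (F k) p w) := fun j k => by linarith [e j k]
  rw [eta_comm (columns F p z)]
  simp only [columns, columnsDeriv, eta_add_left, eta_add_right, eta_smul_left, eta_smul_right, c]
  linear_combination (w 0 * y 0 + w 1 * y 1 + w 2 * y 2) * hz
    + (w 0 * z 0 + w 1 * z 1 + w 2 * z 2) * hy

/-- The normal components of the derivative of `F` are the second fundamental forms. -/
theorem eta_normal_columnsDeriv {l : E3 → Mink} (hl : ContDiffAt ℝ ∞ l p)
    (hlF : ∀ x ∈ sphere (0 : E3) 1, ∀ k, eta (l x) (F k x) = 0) {w : E3} (hw : IsTangent p w)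
    (z : E3) :
    eta (columnsDeriv F p w z) (l p) = -eta (columns F p z) (fderiv ℝ l p w) := by
  have e := fun k => eta_fderiv_of_eqOn_const hp hl (hF.smooth k p hp) (hlF · · k) hw
  rw [eta_comm, eta_comm (columns F p z)]
  simp only [columns, columnsDeriv, eta_add_right, eta_smul_right]
  linear_combination z 0 * e 0 + z 1 * e 1 + z 2 * e 2

end IsTangentIsometry

/-- The exterior derivative of the connection form `½ ε_ijk x_i η(F_j, dF_k)`, which is the difference
of the connection forms of the image plane bundle and of the round sphere. -/
def connectionCurvature (F : Fin 3 → E3 → Mink) (p : E3) : ℝ :=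
  2⁻¹ * ((etaBracket (fun x => x 0 • F 1 x) (F 2) p - etaBracket (fun x => x 0 • F 2 x) (F 1) p)
    + (etaBracket (fun x => x 1 • F 2 x) (F 0) p - etaBracket (fun x => x 1 • F 0 x) (F 2) p)
    + (etaBracket (fun x => x 2 • F 0 x) (F 1) p - etaBracket (fun x => x 2 • F 1 x) (F 0) p))

theorem contDiffAt_coord_smul {A : E3 → Mink} {p : E3} (hA : ContDiffAt ℝ ∞ A p) (i : Fin 3) :
    ContDiffAt ℝ ∞ (fun x : E3 => x i • A x) p :=
  (contDiff_coord i).contDiffAt.smul hA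

theorem fderiv_coord_smul {A : E3 → Mink} {p : E3} (hA : DifferentiableAt ℝ A p) (i : Fin 3)
    (w : E3) : fderiv ℝ (fun x : E3 => x i • A x) p w = p i • fderiv ℝ A p w + w i • A p := by
  refine (congrArg (fun L : E3 →L[ℝ] Mink => L w)
    ((hasFDerivAt_coord i p).smul hA.hasFDerivAt).fderiv).trans ?_
  simp

namespace IsTangentIsometry

variable {F : Fin 3 → E3 → Mink} (hF : IsTangentIsometry F)

include hF

theorem integral_connectionCurvature :
    Integrable (fun p : sphere (0 : E3) 1 => connectionCurvature F p)
      (volume : Measure E3).toSphere ∧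
    ∫ p : sphere (0 : E3) 1, connectionCurvature F p ∂(volume : Measure E3).toSphere = 0 := by
  have i : ∀ i j k, Integrable (fun p : sphere (0 : E3) 1 =>
      etaBracket (fun x => x i • F j x) (F k) p) (volume : Measure E3).toSphere := fun i j k =>
    integrable_etaBracket (fun p hp => contDiffAt_coord_smul (hF.smooth j p hp) i) (hF.smooth k)
  have z : ∀ i j k, ∫ p : sphere (0 : E3) 1, etaBracket (fun x => x i • F j x) (F k) p
      ∂(volume : Measure E3).toSphere = 0 := fun i j k =>
    integral_etaBracket (fun p hp => contDiffAt_coord_smul (hF.smooth j p hp) i) (hF.smooth k)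
  have e0 := integral_sub (i 0 1 2) (i 0 2 1)
  have e1 := integral_sub (i 1 2 0) (i 1 0 2)
  have e2 := integral_sub (i 2 0 1) (i 2 1 0)
  have e3 := integral_add ((i 0 1 2).sub (i 0 2 1)) ((i 1 2 0).sub (i 1 0 2))
  have e4 := integral_add (((i 0 1 2).sub (i 0 2 1)).add ((i 1 2 0).sub (i 1 0 2)))
    ((i 2 0 1).sub (i 2 1 0))
  simp only [Pi.add_apply, Pi.sub_apply] at e0 e1 e2 e3 e4
  refine ⟨((((i 0 1 2).sub (i 0 2 1)).add ((i 1 2 0).sub (i 1 0 2))).add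
    ((i 2 0 1).sub (i 2 1 0))).const_mul _, ?_⟩
  unfold connectionCurvature
  rw [integral_const_mul, e4, e3, e0, e1, e2]
  simp [z]

/-- The connection form of the round sphere contributes its curvature `1`. In the remaining term
the tangential parts of the derivatives of `F` drop out, see `integral_mixedDet`. -/
theorem connectionCurvature_eq {p u v : E3} (hp : p ∈ sphere (0 : E3) 1) (h : IsFrame p u v) :
    connectionCurvature F p = 1 + (eta (columnsDeriv F p u u) (columnsDeriv F p v v)
      - eta (columnsDeriv F p u v) (columnsDeriv F p v u)) := by
  have hd := hF.differentiableAt hp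
  have hs : ∀ i k, DifferentiableAt ℝ (fun x : E3 => x i • F k x) p := fun i k =>
    (contDiffAt_coord_smul (hF.smooth k p hp) i).differentiableAt (by simp)
  -- contraction with the position vector on either side
  have pl : ∀ x : Mink, p 0 * eta (F 0 p) x + p 1 * eta (F 1 p) x + p 2 * eta (F 2 p) x = 0 := by
    intro x
    have := congrArg (fun y => eta y x) (hF.radial p hp)
    simpa only [columns, eta_add_left, eta_smul_left, eta_zero_left] using this
  have pr : ∀ w, IsTangent p w → ∀ z, eta (columns F p z) (columnsDeriv F p w p) =
      - eta (columns F p z) (columns F p w) := fun w hw z => by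
    rw [hF.columnsDeriv_radial hp hw, eta_neg_right]
  have prv := pr v h.tangent_right v
  have pru := pr u h.tangent_left u
  rw [hF.eta_columns hp, h.pv, h.vv] at prv
  rw [hF.eta_columns hp, h.pu, h.uu] at pru
  have plv := pl (columnsDeriv F p v v)
  have plu := pl (columnsDeriv F p u u)
  have u0 : u 0 = v 1 * p 2 - v 2 * p 1 := by
    rw [h.p1, h.p2]; linear_combination (-u 0) * h.vv + v 0 * h.uv
  have u1 : u 1 = v 2 * p 0 - v 0 * p 2 := by
    rw [h.p0, h.p2]; linear_combination (-u 1) * h.vv + v 1 * h.uv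
  have u2 : u 2 = v 0 * p 1 - v 1 * p 0 := by
    rw [h.p0, h.p1]; linear_combination (-u 2) * h.vv + v 2 * h.uv
  have v0 : v 0 = p 1 * u 2 - p 2 * u 1 := by
    rw [h.p1, h.p2]; linear_combination (-v 0) * h.uu + u 0 * h.uv
  have v1 : v 1 = p 2 * u 0 - p 0 * u 2 := by
    rw [h.p0, h.p2]; linear_combination (-v 1) * h.uu + u 1 * h.uv
  have v2 : v 2 = p 0 * u 1 - p 1 * u 0 := by
    rw [h.p0, h.p1]; linear_combination (-v 2) * h.uu + u 2 * h.uv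
  simp only [connectionCurvature, h.etaBracket_eq (hs _ _) (hd _), fderiv_coord_smul (hd _)]
  simp only [columns, columnsDeriv, eta_add_left, eta_add_right, eta_smul_left,
    eta_smul_right] at prv pru plv plu ⊢
  have comm : ∀ j k, eta (fderiv ℝ (F j) p v) (fderiv ℝ (F k) p u) =
    eta (fderiv ℝ (F k) p u) (fderiv ℝ (F j) p v) := fun j k => eta_comm _ _
  simp only [comm]
  generalize hA : (fun j k => eta (F j p) (fderiv ℝ (F k) p v)) = A at *
  generalize hB : (fun j k => eta (F j p) (fderiv ℝ (F k) p u)) = B at *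
  generalize hC : (fun j k => eta (fderiv ℝ (F j) p u) (fderiv ℝ (F k) p v)) = C at *
  have hA' : ∀ j k, eta (F j p) (fderiv ℝ (F k) p v) = A j k := fun j k => by rw [← hA]
  have hB' : ∀ j k, eta (F j p) (fderiv ℝ (F k) p u) = B j k := fun j k => by rw [← hB]
  have hC' : ∀ j k, eta (fderiv ℝ (F j) p u) (fderiv ℝ (F k) p v) = C j k := fun j k => by
    rw [← hC]
  simp only [hA', hB', hC'] at *
  have k1 : u 0 * (A 1 2 - A 2 1) + u 1 * (A 2 0 - A 0 2) + u 2 * (A 0 1 - A 1 0) = 1 := by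
    rw [u0, u1, u2]
    linear_combination prv - plv
  have k2 : v 0 * (B 1 2 - B 2 1) + v 1 * (B 2 0 - B 0 2) + v 2 * (B 0 1 - B 1 0) = -1 := by
    rw [v0, v1, v2]
    linear_combination - pru + plu
  have k3 : p 0 * (C 1 2 - C 2 1) + p 1 * (C 2 0 - C 0 2) + p 2 * (C 0 1 - C 1 0) =
      (u 1 * v 2 - u 2 * v 1) * (C 1 2 - C 2 1) + (u 2 * v 0 - u 0 * v 2) * (C 2 0 - C 0 2)
        + (u 0 * v 1 - u 1 * v 0) * (C 0 1 - C 1 0) := by rw [h.p0, h.p1, h.p2]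
  linear_combination (1 / 2 : ℝ) * k1 - (1 / 2 : ℝ) * k2 + k3

/-- **Gauss–Bonnet** for a plane bundle `E` in the trivial Minkowski bundle over the sphere that is
isometric to the tangent bundle and is the orthogonal complement of two null fields `l, n`: the
curvature of `E`, which by the Gauss equation is minus the mixed determinant of the two null second
fundamental forms, integrates to `4π`. -/
theorem integral_mixedDet {l n : E3 → Mink}
    (hl : ∀ p ∈ sphere (0 : E3) 1, ContDiffAt ℝ ∞ l p)
    (hn : ∀ p ∈ sphere (0 : E3) 1, ContDiffAt ℝ ∞ n p)
    (ll : ∀ p ∈ sphere (0 : E3) 1, eta (l p) (l p) = 0)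
    (nn : ∀ p ∈ sphere (0 : E3) 1, eta (n p) (n p) = 0)
    (ln : ∀ p ∈ sphere (0 : E3) 1, eta (l p) (n p) = 1)
    (lF : ∀ p ∈ sphere (0 : E3) 1, ∀ k, eta (l p) (F k p) = 0)
    (nF : ∀ p ∈ sphere (0 : E3) 1, ∀ k, eta (n p) (F k p) = 0)
    (q : sphere (0 : E3) 1 → ℝ)
    (hq : ∀ (p : sphere (0 : E3) 1) (u v : E3), IsFrame p u v →
      q p = mixedDet (columns F p u) (columns F p v) (fderiv ℝ l p u) (fderiv ℝ l p v)
        (fderiv ℝ n p u) (fderiv ℝ n p v)) :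
    Integrable q (volume : Measure E3).toSphere ∧
    ∫ p, q p ∂(volume : Measure E3).toSphere = -(4 * Real.pi) := by
  -- expand the derivatives of `F` in the null frame `l, n, F u, F v`
  have key : ∀ p, q p = connectionCurvature F p - 1 := by
    intro p
    obtain ⟨u, v, h⟩ := exists_isFrame p.2
    have hu := h.tangent_left
    have hv := h.tangent_right
    have dl := hl p p.2
    have dn := hn p p.2
    have lc : ∀ z, eta (l p) (columns F p z) = 0 := fun z => by
      simp [columns, eta_add_right, eta_smul_right, lF p p.2]
    have nc : ∀ z, eta (n p) (columns F p z) = 0 := fun z => by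
      simp [columns, eta_add_right, eta_smul_right, nF p p.2]
    have cpl := eta_eq_of_null_frame (ll p p.2) (nn p p.2) (ln p p.2) (lc u) (lc v) (nc u) (nc v)
      (by rw [hF.eta_columns p.2, h.pu, h.uu]; norm_num)
      (by rw [hF.eta_columns p.2, h.pv, h.vv]; norm_num)
      (by rw [hF.eta_columns p.2, h.pu, h.uv]; norm_num)
    have s : ∀ w, IsTangent (p : E3) w → ∀ z, IsTangent (p : E3) z →
        eta (columnsDeriv F p w z) (columns F p z) = 0 := fun w hw z hz => by
      have := hF.eta_columns_columnsDeriv p.2 hw hz hz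
      rw [eta_comm]; linarith
    rw [hF.connectionCurvature_eq p.2 h, hq p u v h, mixedDet, cpl (columnsDeriv F p u u),
      cpl (columnsDeriv F p u v), s u hu u hu, s u hu v hv, s v hv u hu, s v hv v hv,
      hF.eta_normal_columnsDeriv p.2 dl lF hu, hF.eta_normal_columnsDeriv p.2 dl lF hu,
      hF.eta_normal_columnsDeriv p.2 dl lF hv, hF.eta_normal_columnsDeriv p.2 dl lF hv,
      hF.eta_normal_columnsDeriv p.2 dn nF hu, hF.eta_normal_columnsDeriv p.2 dn nF hu,
      hF.eta_normal_columnsDeriv p.2 dn nF hv, hF.eta_normal_columnsDeriv p.2 dn nF hv]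
    ring
  obtain ⟨hi, h0⟩ := hF.integral_connectionCurvature
  obtain rfl : q = fun p : sphere (0 : E3) 1 => connectionCurvature F p - 1 := funext key
  refine ⟨hi.sub (integrable_const 1), ?_⟩
  rw [integral_sub hi (integrable_const 1), h0, integral_one_sphere]
  ring

end IsTangentIsometry

/-! ### The isometric part of the differential of a space-like sphere -/

theorem IsFrame.completeness {p u v : E3} (h : IsFrame p u v) (j k : Fin 3) :
    u j * u k + v j * v k = (if j = k then 1 else 0) - p j * p k := by
  let M : Matrix (Fin 3) (Fin 3) ℝ := !![p 0, p 1, p 2; u 0, u 1, u 2; v 0, v 1, v 2]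
  have h1 : M * M.transpose = 1 := by
    ext i j
    fin_cases i <;> fin_cases j <;> simp [M, Matrix.mul_apply, Fin.sum_univ_three] <;>
      linarith [h.pp, h.uu, h.vv, h.uv, h.pu, h.pv]
  have h2 := congrFun (congrFun (mul_eq_one_comm.1 h1 : M.transpose * M = 1) j) k
  rw [Matrix.one_apply] at h2
  rw [← h2]
  fin_cases j <;> fin_cases k <;> simp [M, Matrix.mul_apply, Fin.sum_univ_three] <;> ring

theorem IsFrame.eq_combination {p u v : E3} (h : IsFrame p u v) {w : E3} (hw : IsTangent p w) :
    w = ⟪u, w⟫ • u + ⟪v, w⟫ • v := by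
  rw [IsTangent, inner_eq_coord] at hw
  have c := h.completeness
  have e : ∀ k : Fin 3, w k = ⟪u, w⟫ * u k + ⟪v, w⟫ * v k := fun k => by
    rw [inner_eq_coord, inner_eq_coord]
    have c0 := c 0 k
    have c1 := c 1 k
    have c2 := c 2 k
    fin_cases k <;> simp at c0 c1 c2 ⊢
    · linear_combination (-w 0) * c0 - w 1 * c1 - w 2 * c2 + p 0 * hw
    · linear_combination (-w 0) * c0 - w 1 * c1 - w 2 * c2 + p 1 * hw
    · linear_combination (-w 0) * c0 - w 1 * c1 - w 2 * c2 + p 2 * hw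
  ext k
  simpa using e k

namespace SpacelikeSphere

variable (S : SpacelikeSphere)

/-- The image under `dX` of the tangential projection of the `k`-th standard basis vector. -/
def tangentField (k : Fin 3) (x : E3) : Mink := fderiv ℝ S.X x (stdVec k - x k • x)

/-- The matrix of the induced metric, pulled back to `ℝ³` by the tangential projection. -/
def pullbackMetric (j k : Fin 3) (x : E3) : ℝ := -eta (S.tangentField j x) (S.tangentField k x)

/-- The trace of the induced metric with respect to the round metric. -/
def metricTrace (x : E3) : ℝ :=
  S.pullbackMetric 0 0 x + S.pullbackMetric 1 1 x + S.pullbackMetric 2 2 x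

/-- The determinant of the induced metric with respect to the round metric, as the sum of the
principal minors of the pulled back matrix (which is degenerate in the radial direction). -/
def metricDet (x : E3) : ℝ :=
  (S.pullbackMetric 0 0 x * S.pullbackMetric 1 1 x
    - S.pullbackMetric 0 1 x * S.pullbackMetric 0 1 x)
  + (S.pullbackMetric 0 0 x * S.pullbackMetric 2 2 x
    - S.pullbackMetric 0 2 x * S.pullbackMetric 0 2 x)
  + (S.pullbackMetric 1 1 x * S.pullbackMetric 2 2 x
    - S.pullbackMetric 1 2 x * S.pullbackMetric 1 2 x)

/-- A smooth extension of the area density to a neighbourhood of the unit sphere. -/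
def density (x : E3) : ℝ := Real.sqrt (S.metricDet x)

/-- The trace of the square root of the induced metric with respect to the round metric. -/
def sqrtTrace (x : E3) : ℝ := Real.sqrt (S.metricTrace x + 2 * S.density x)

/-- The columns of the isometric part of the polar decomposition of `dX`. A positive `2 × 2` matrix
`M` with determinant `d²` has square root `(M + d) / s`, where `s² = tr M + 2 d`, and the inverse of
this root is `(tr M + d - M) / (s d)`. -/
def isometry (k : Fin 3) (x : E3) : Mink :=
  (S.sqrtTrace x * S.density x)⁻¹ • ((S.metricTrace x + S.density x) • S.tangentField k x
    - (S.pullbackMetric k 0 x • S.tangentField 0 x + S.pullbackMetric k 1 x • S.tangentField 1 x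
      + S.pullbackMetric k 2 x • S.tangentField 2 x))

theorem metric_comm (p u v : E3) : S.metric p u v = S.metric p v u := by
  rw [metric, metric, eta_comm]

theorem metric_combination (p u v : E3) (a b c e : ℝ) :
    S.metric p (a • u + b • v) (c • u + e • v) =
      a * c * S.metric p u u + (a * e + b * c) * S.metric p u v + b * e * S.metric p v v := by
  simp only [metric, map_add, map_smul, eta_add_left, eta_add_right, eta_smul_left, eta_smul_right,
    eta_comm (fderiv ℝ S.X p v) (fderiv ℝ S.X p u)]
  ring

theorem gram_combination (p u v : E3) (a b c e : ℝ) :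
    S.gram p (a • u + b • v) (c • u + e • v) = (a * e - b * c) ^ 2 * S.gram p u v := by
  simp only [gram, metric_combination, S.metric_comm p v u]
  ring

variable {S} in
theorem metric_pos {p w : E3} (hp : p ∈ sphere (0 : E3) 1) (hw : IsTangent p w) (hw0 : w ≠ 0) :
    0 < S.metric p w w :=
  neg_pos.2 (S.spacelike p hp w hw hw0)

section Frame

variable {S} {p u v : E3} (hp : p ∈ sphere (0 : E3) 1) (h : IsFrame p u v)

include h

theorem tangentField_eq (k : Fin 3) :
    S.tangentField k p = u k • fderiv ℝ S.X p u + v k • fderiv ℝ S.X p v := by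
  rw [tangentField, ← map_smul, ← map_smul, ← map_add]
  congr 1
  ext j
  have := h.completeness k j
  simp [stdVec]
  rw [this]
  simp [eq_comm]

theorem pullbackMetric_eq (j k : Fin 3) : S.pullbackMetric j k p =
    u j * u k * S.metric p u u + (u j * v k + v j * u k) * S.metric p u v
      + v j * v k * S.metric p v v := by
  simp only [pullbackMetric, tangentField_eq h, metric, eta_add_left, eta_add_right, eta_smul_left,
    eta_smul_right, eta_comm (fderiv ℝ S.X p v) (fderiv ℝ S.X p u)]
  ring

theorem metricTrace_eq : S.metricTrace p = S.metric p u u + S.metric p v v := by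
  simp only [metricTrace, pullbackMetric_eq h]
  linear_combination S.metric p u u * h.uu + S.metric p v v * h.vv + 2 * S.metric p u v * h.uv

theorem metricDet_eq : S.metricDet p = S.gram p u v := by
  simp only [metricDet, pullbackMetric_eq h, gram, S.metric_comm p v u]
  linear_combination (S.metric p u u * S.metric p v v - S.metric p u v * S.metric p u v) *
    ((v 0 * v 0 + v 1 * v 1 + v 2 * v 2) * h.uu + h.vv
      - (u 0 * v 0 + u 1 * v 1 + u 2 * v 2) * h.uv)

include hp

theorem metric_left_pos : 0 < S.metric p u u :=
  metric_pos hp h.tangent_left fun h0 => by simpa [h0] using h.uu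

theorem metric_right_pos : 0 < S.metric p v v :=
  metric_pos hp h.tangent_right fun h0 => by simpa [h0] using h.vv

theorem gram_pos : 0 < S.gram p u v := by
  have hG := metric_right_pos (S := S) hp h
  -- the metric at `G u - f v`, where `G = g(v, v)` and `f = g(u, v)`, is `G` times the determinant
  have ht : IsTangent p (S.metric p v v • u + (-S.metric p u v) • v) := by
    have h1 : ⟪p, u⟫ = 0 := h.tangent_left
    have h2 : ⟪p, v⟫ = 0 := h.tangent_right
    rw [IsTangent, inner_add_right, real_inner_smul_right, real_inner_smul_right, h1, h2]
    ring
  have h0 : S.metric p v v • u + (-S.metric p u v) • v ≠ 0 := fun h0 => by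
    have h1 : ⟪u, S.metric p v v • u + (-S.metric p u v) • v⟫ = 0 := by rw [h0, inner_zero_right]
    rw [inner_add_right, real_inner_smul_right, real_inner_smul_right, inner_eq_coord,
      inner_eq_coord, h.uu, h.uv] at h1
    linarith
  have h1 := metric_pos (S := S) hp ht h0
  rw [metric_combination] at h1
  have h2 : 0 < S.metric p v v * S.gram p u v := by
    rw [gram, S.metric_comm p v u]
    linarith
  exact pos_of_mul_pos_right h2 hG.le

theorem density_sq : S.density p ^ 2 = S.gram p u v := by
  rw [density, metricDet_eq h, Real.sq_sqrt (gram_pos hp h).le]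

theorem density_pos : 0 < S.density p := by
  rw [density, metricDet_eq h]; exact Real.sqrt_pos.2 (gram_pos hp h)

theorem metricTrace_add_pos : 0 < S.metricTrace p + 2 * S.density p := by
  rw [metricTrace_eq h]
  linarith [metric_left_pos (S := S) hp h, metric_right_pos (S := S) hp h,
    density_pos (S := S) hp h]

theorem sqrtTrace_sq :
    S.sqrtTrace p ^ 2 = S.metric p u u + S.metric p v v + 2 * S.density p := by
  rw [sqrtTrace, Real.sq_sqrt (metricTrace_add_pos hp h).le, metricTrace_eq h]

theorem sqrtTrace_pos : 0 < S.sqrtTrace p := Real.sqrt_pos.2 (metricTrace_add_pos hp h)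

omit hp in
theorem isometry_eq (k : Fin 3) : S.isometry k p =
    u k • ((S.sqrtTrace p * S.density p)⁻¹ • ((S.metric p v v + S.density p) • fderiv ℝ S.X p u
      - S.metric p u v • fderiv ℝ S.X p v))
    + v k • ((S.sqrtTrace p * S.density p)⁻¹ • ((S.metric p u u + S.density p) • fderiv ℝ S.X p v
      - S.metric p u v • fderiv ℝ S.X p u)) := by
  rw [isometry, metricTrace_eq h]
  simp only [pullbackMetric_eq h, tangentField_eq h]
  generalize (S.sqrtTrace p * S.density p)⁻¹ = c
  generalize S.metric p u u = E
  generalize S.metric p v v = G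
  generalize S.metric p u v = f
  ext a
  simp only [Pi.add_apply, Pi.sub_apply, Pi.smul_apply, smul_eq_mul]
  generalize fderiv ℝ S.X p u a = x
  generalize fderiv ℝ S.X p v a = y
  linear_combination (-c * (u k * E * x + v k * f * x)) * h.uu
    - (c * (u k * f * x + v k * G * x + u k * E * y + v k * f * y)) * h.uv
    - (c * (u k * f * y + v k * G * y)) * h.vv

omit hp in
theorem columns_isometry (z : E3) : columns S.isometry p z =
    (u 0 * z 0 + u 1 * z 1 + u 2 * z 2) • ((S.sqrtTrace p * S.density p)⁻¹ •
      ((S.metric p v v + S.density p) • fderiv ℝ S.X p u - S.metric p u v • fderiv ℝ S.X p v))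
    + (v 0 * z 0 + v 1 * z 1 + v 2 * z 2) • ((S.sqrtTrace p * S.density p)⁻¹ •
      ((S.metric p u u + S.density p) • fderiv ℝ S.X p v
        - S.metric p u v • fderiv ℝ S.X p u)) := by
  rw [columns]
  simp only [isometry_eq h]
  module

theorem eta_isometry (j k : Fin 3) :
    eta (S.isometry j p) (S.isometry k p) = p j * p k - if j = k then 1 else 0 := by
  have hd := density_pos (S := S) hp h
  have hs := sqrtTrace_pos (S := S) hp h
  have hs2 := sqrtTrace_sq (S := S) hp h
  have hd2 := density_sq (S := S) hp h
  rw [gram, S.metric_comm p v u] at hd2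
  have huu : eta (fderiv ℝ S.X p u) (fderiv ℝ S.X p u) = -S.metric p u u := by simp [metric]
  have hvv : eta (fderiv ℝ S.X p v) (fderiv ℝ S.X p v) = -S.metric p v v := by simp [metric]
  have huv : eta (fderiv ℝ S.X p u) (fderiv ℝ S.X p v) = -S.metric p u v := by simp [metric]
  have hvu : eta (fderiv ℝ S.X p v) (fderiv ℝ S.X p u) = -S.metric p u v := by
    rw [eta_comm, huv]
  have hjk := h.completeness j k
  have hne : S.sqrtTrace p * S.density p ≠ 0 := (mul_pos hs hd).ne'
  have hc : (S.sqrtTrace p * S.density p)⁻¹ ^ 2 * (S.sqrtTrace p ^ 2 * S.density p ^ 2) = 1 := by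
    field_simp
  rw [hs2] at hc
  simp only [isometry_eq h, eta_add_left, eta_add_right, eta_sub_left, eta_sub_right,
    eta_smul_left, eta_smul_right, huu, hvv, huv, hvu]
  generalize (S.sqrtTrace p * S.density p)⁻¹ = c at *
  generalize S.metric p u u = E at *
  generalize S.metric p v v = G at *
  generalize S.metric p u v = f at *
  generalize S.density p = d at *
  linear_combination (-1 : ℝ) * hjk - (u j * u k + v j * v k) * hc
    + c ^ 2 * (u j * u k * (G + 2 * d) + v j * v k * (E + 2 * d)
      - (u j * v k + v j * u k) * f) * hd2

/-- On the tangent plane the isometric part is `dX` composed with a symmetric map of determinant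
the inverse of the area density. -/
theorem exists_isometry_coeff : ∃ α β γ : ℝ,
    columns S.isometry p u = α • fderiv ℝ S.X p u + β • fderiv ℝ S.X p v ∧
    columns S.isometry p v = β • fderiv ℝ S.X p u + γ • fderiv ℝ S.X p v ∧
    (α * γ - β * β) * S.density p = 1 := by
  have hd := density_pos (S := S) hp h
  have hs := sqrtTrace_pos (S := S) hp h
  have hs2 := sqrtTrace_sq (S := S) hp h
  have hd2 := density_sq (S := S) hp h
  rw [gram, S.metric_comm p v u] at hd2
  refine ⟨(S.sqrtTrace p * S.density p)⁻¹ * (S.metric p v v + S.density p),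
    -((S.sqrtTrace p * S.density p)⁻¹ * S.metric p u v),
    (S.sqrtTrace p * S.density p)⁻¹ * (S.metric p u u + S.density p), ?_, ?_, ?_⟩
  · rw [columns_isometry h, h.uu, show v 0 * u 0 + v 1 * u 1 + v 2 * u 2 = 0 by linarith [h.uv]]
    module
  · rw [columns_isometry h, h.vv, h.uv]
    module
  · have hne : S.sqrtTrace p * S.density p ≠ 0 := (mul_pos hs hd).ne'
    have hc : (S.sqrtTrace p * S.density p)⁻¹ ^ 2 * (S.sqrtTrace p ^ 2 * S.density p ^ 2) = 1 := by
      field_simp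
    rw [hs2] at hc
    linear_combination hc - (S.sqrtTrace p * S.density p)⁻¹ ^ 2 * S.density p * hd2

/-- The mixed determinant of the isometric part of `dX`, on a round orthonormal frame, is that of
`dX` on an orthonormal frame of the induced metric, times the area density. -/
theorem mixedDet_isometry {e₁ e₂ : E3} (h₁ : IsTangent p e₁) (h₂ : IsTangent p e₂)
    (h₁₁ : S.metric p e₁ e₁ = 1) (h₂₂ : S.metric p e₂ e₂ = 1) (h₁₂ : S.metric p e₁ e₂ = 0)
    (L N : E3 →L[ℝ] Mink) :
    mixedDet (columns S.isometry p u) (columns S.isometry p v) (L u) (L v) (N u) (N v) =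
      S.density p * mixedDet (fderiv ℝ S.X p e₁) (fderiv ℝ S.X p e₂) (L e₁) (L e₂) (N e₁)
        (N e₂) := by
  obtain ⟨α, β, γ, hu, hv, hdet⟩ := exists_isometry_coeff (S := S) hp h
  have hd := density_pos (S := S) hp h
  have hd2 := density_sq (S := S) hp h
  have hg : S.gram p e₁ e₂ = 1 := by rw [gram, S.metric_comm p e₂ e₁, h₁₁, h₂₂, h₁₂]; norm_num
  have E₁ := h.eq_combination h₁
  have E₂ := h.eq_combination h₂
  generalize ⟪u, e₁⟫ = a at E₁
  generalize ⟪v, e₁⟫ = b at E₁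
  generalize ⟪u, e₂⟫ = c at E₂
  generalize ⟪v, e₂⟫ = e at E₂
  subst E₁ E₂
  rw [gram_combination, ← hd2] at hg
  rw [hu, hv]
  have hl : mixedDet (α • fderiv ℝ S.X p u + β • fderiv ℝ S.X p v)
      (β • fderiv ℝ S.X p u + γ • fderiv ℝ S.X p v) (L u) (L v) (N u) (N v) =
      (α * γ - β * β) * mixedDet (fderiv ℝ S.X p u) (fderiv ℝ S.X p v) (L u) (L v) (N u) (N v) := by
    simp only [mixedDet, eta_add_left, eta_smul_left]
    ring
  have hr : mixedDet (fderiv ℝ S.X p (a • u + b • v)) (fderiv ℝ S.X p (c • u + e • v))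
      (L (a • u + b • v)) (L (c • u + e • v)) (N (a • u + b • v)) (N (c • u + e • v)) =
      (a * e - b * c) ^ 2 *
        mixedDet (fderiv ℝ S.X p u) (fderiv ℝ S.X p v) (L u) (L v) (N u) (N v) := by
    simp only [mixedDet, map_add, map_smul, eta_add_left, eta_smul_left, eta_add_right,
      eta_smul_right]
    ring
  rw [hl, hr]
  have : α * γ - β * β = S.density p * (a * e - b * c) ^ 2 := by
    have h1 : (α * γ - β * β - S.density p * (a * e - b * c) ^ 2) * S.density p = 0 := by
      linear_combination hdet - hg
    linarith [(mul_eq_zero.1 h1).resolve_right hd.ne']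
  rw [this]
  ring

end Frame

theorem contDiffAt_tangentField (k : Fin 3) {p : E3} (hp : p ∈ sphere (0 : E3) 1) :
    ContDiffAt ℝ ∞ (S.tangentField k) p :=
  ((S.smooth p hp).fderiv_right (m := ∞) (by simp)).clm_apply
    (contDiffAt_const.sub ((contDiff_coord k).contDiffAt.smul contDiffAt_id))

theorem contDiffAt_pullbackMetric (j k : Fin 3) {p : E3} (hp : p ∈ sphere (0 : E3) 1) :
    ContDiffAt ℝ ∞ (S.pullbackMetric j k) p :=
  (contDiffAt_eta (S.contDiffAt_tangentField j hp) (S.contDiffAt_tangentField k hp)).neg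

theorem contDiffAt_density {p : E3} (hp : p ∈ sphere (0 : E3) 1) : ContDiffAt ℝ ∞ S.density p := by
  obtain ⟨u, v, h⟩ := exists_isFrame hp
  have m := fun j k => S.contDiffAt_pullbackMetric j k hp
  have hd : ContDiffAt ℝ ∞ S.metricDet p :=
    ((((m 0 0).mul (m 1 1)).sub ((m 0 1).mul (m 0 1))).add
      (((m 0 0).mul (m 2 2)).sub ((m 0 2).mul (m 0 2)))).add
      (((m 1 1).mul (m 2 2)).sub ((m 1 2).mul (m 1 2)))
  exact hd.sqrt (by rw [metricDet_eq h]; exact (gram_pos hp h).ne')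

theorem contDiffAt_metricTrace {p : E3} (hp : p ∈ sphere (0 : E3) 1) :
    ContDiffAt ℝ ∞ S.metricTrace p :=
  ((S.contDiffAt_pullbackMetric 0 0 hp).add (S.contDiffAt_pullbackMetric 1 1 hp)).add
    (S.contDiffAt_pullbackMetric 2 2 hp)

theorem contDiffAt_isometry (k : Fin 3) {p : E3} (hp : p ∈ sphere (0 : E3) 1) :
    ContDiffAt ℝ ∞ (S.isometry k) p := by
  obtain ⟨u, v, h⟩ := exists_isFrame hp
  have hd := S.contDiffAt_density hp
  have ht := S.contDiffAt_metricTrace hp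
  have hs : ContDiffAt ℝ ∞ S.sqrtTrace p :=
    (ht.add (contDiffAt_const.mul hd)).sqrt (metricTrace_add_pos hp h).ne'
  have hY := fun k => S.contDiffAt_tangentField k hp
  have hm := fun j => S.contDiffAt_pullbackMetric k j hp
  exact ((hs.mul hd).inv (mul_pos (sqrtTrace_pos hp h) (density_pos hp h)).ne').smul
    (((ht.add hd).smul (hY k)).sub
      ((((hm 0).smul (hY 0)).add ((hm 1).smul (hY 1))).add ((hm 2).smul (hY 2))))

theorem isTangentIsometry : IsTangentIsometry S.isometry where
  smooth k p hp := S.contDiffAt_isometry k hp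
  radial p hp := by
    obtain ⟨u, v, h⟩ := exists_isFrame hp
    rw [columns_isometry h, show u 0 * p 0 + u 1 * p 1 + u 2 * p 2 = 0 by linarith [h.pu],
      show v 0 * p 0 + v 1 * p 1 + v 2 * p 2 = 0 by linarith [h.pv], zero_smul, zero_smul, add_zero]
  inner p hp j k := by
    obtain ⟨u, v, h⟩ := exists_isFrame hp
    exact eta_isometry hp h j k

/-- A normal vector of the surface is orthogonal to the image of the isometric part of `dX`. -/
theorem eta_isometry_of_normal {p : E3} (hp : p ∈ sphere (0 : E3) 1) {l : Mink}
    (hl : ∀ v, IsTangent p v → eta l (fderiv ℝ S.X p v) = 0) (k : Fin 3) :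
    eta l (S.isometry k p) = 0 := by
  obtain ⟨u, v, h⟩ := exists_isFrame hp
  simp [isometry_eq h, eta_add_right, eta_sub_right, eta_smul_right, hl u h.tangent_left,
    hl v h.tangent_right]

theorem areaDensity_eq_density (p : sphere (0 : E3) 1) : S.areaDensity p = S.density p := by
  obtain ⟨u, v, h⟩ := exists_isFrame p.2
  rw [S.areaDensity_eq p u v h.tangent_left h.tangent_right (by rw [inner_eq_coord, h.uu])
    (by rw [inner_eq_coord, h.vv]) (by rw [inner_eq_coord, h.uv]), density, metricDet_eq h]

/-- Integrals over the surface as integrals over the round sphere. -/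
theorem integral_area (f : sphere (0 : E3) 1 → ℂ) :
    ∫ p, f p ∂S.area = ∫ p, (S.density p : ℂ) * f p ∂(volume : Measure E3).toSphere := by
  have hc : Continuous fun p : sphere (0 : E3) 1 => S.density p :=
    continuous_sphere_of_contDiffAt fun p hp => S.contDiffAt_density hp
  have e : S.area = (volume : Measure E3).toSphere.withDensity
      fun p : sphere (0 : E3) 1 => ENNReal.ofReal (S.density p) := by
    unfold area
    simp only [areaDensity_eq_density]
  rw [e, integral_withDensity_eq_integral_toReal_smul hc.measurable.ennreal_ofReal
    (Filter.Eventually.of_forall fun _ => ENNReal.ofReal_lt_top)]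
  refine integral_congr_ae (Filter.Eventually.of_forall fun p => ?_)
  simp only [density, ENNReal.toReal_ofReal (Real.sqrt_nonneg _), Complex.real_smul]

end SpacelikeSphere

/-! ### Second fundamental forms along null normals -/

theorem eta_ne_zero_of_timelike_null {t l : Mink} (ht : 0 < eta t t) (hl : eta l l = 0)
    (hl0 : 0 < l 0) : eta t l ≠ 0 := by
  intro h
  simp only [eta] at ht hl h
  have h1 : (t 0 * l 0) ^ 2 = (t 1 * l 1 + t 2 * l 2 + t 3 * l 3) ^ 2 := by
    rw [show t 0 * l 0 = t 1 * l 1 + t 2 * l 2 + t 3 * l 3 by linarith]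
  -- Cauchy–Schwarz for the spatial parts
  have h2 : (t 1 * l 1 + t 2 * l 2 + t 3 * l 3) ^ 2 ≤
      (t 1 * t 1 + t 2 * t 2 + t 3 * t 3) * (l 0 * l 0) := by
    have : l 0 * l 0 = l 1 * l 1 + l 2 * l 2 + l 3 * l 3 := by linarith
    rw [this]
    nlinarith [sq_nonneg (t 1 * l 2 - t 2 * l 1), sq_nonneg (t 1 * l 3 - t 3 * l 1),
      sq_nonneg (t 2 * l 3 - t 3 * l 2)]
  nlinarith [mul_pos ht (mul_pos hl0 hl0)]

namespace SpacelikeSphere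

variable (S : SpacelikeSphere)

/-- The second fundamental form of the surface along a normal field is symmetric. -/
theorem eta_fderiv_symm {l : E3 → Mink}
    (hl : ∀ p ∈ sphere (0 : E3) 1, ContDiffAt ℝ ∞ l p)
    (hn : ∀ p ∈ sphere (0 : E3) 1, ∀ v, IsTangent p v → eta (l p) (fderiv ℝ S.X p v) = 0)
    {p z w : E3} (hp : p ∈ sphere (0 : E3) 1) (hz : IsTangent p z) (hw : IsTangent p w) :
    eta (fderiv ℝ S.X p z) (fderiv ℝ l p w) = eta (fderiv ℝ S.X p w) (fderiv ℝ l p z) := by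
  have hX : ContDiffAt ℝ ∞ (fderiv ℝ S.X) p := (S.smooth p hp).fderiv_right (by simp)
  have hsymm : fderiv ℝ (fderiv ℝ S.X) p z w = fderiv ℝ (fderiv ℝ S.X) p w z :=
    (contDiffAt_infty.1 (S.smooth p hp) 2).isSymmSndFDerivAt (by simp) z w
  have hdl := (hl p hp).differentiableAt (by simp)
  -- differentiate `η(l, dX z) = 0` along the sphere, after extending `z` to the tangent field
  -- `x ↦ z - ⟪x, z⟫ x`
  have key : ∀ z w : E3, IsTangent p z → IsTangent p w →
      eta (fderiv ℝ S.X p z) (fderiv ℝ l p w) =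
        ⟪z, w⟫ * eta (l p) (fderiv ℝ S.X p p) - eta (l p) (fderiv ℝ (fderiv ℝ S.X) p w z) := by
    intro z w hz hw
    have hz' : ⟪p, z⟫ = 0 := hz
    have hs : HasFDerivAt (fun x : E3 => z - ⟪x, z⟫ • x) _ p := (hasFDerivAt_const z p).sub
      (((hasFDerivAt_id p).inner ℝ (hasFDerivAt_const z p)).smul (hasFDerivAt_id p))
    have hY := (hX.differentiableAt (by simp)).hasFDerivAt.clm_apply hs
    have h := fderiv_congr_of_eqOn_sphere
      (f := fun x => eta (l x) (fderiv ℝ S.X x (z - ⟪x, z⟫ • x)))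
      (g := fun _ => 0) (fun x hx => hn x hx _ (by
        rw [IsTangent, inner_sub_right, real_inner_smul_right, real_inner_self_eq_norm_sq,
          mem_sphere_zero_iff_norm.1 hx]; ring)) hp
      ((contDiffAt_eta ((hl p hp).of_le (m := 1) (by simp)) ((hX.of_le (m := 1) (by simp)).clm_apply
        (contDiffAt_const.sub ((contDiffAt_id.inner ℝ contDiffAt_const).smul
          contDiffAt_id)))).differentiableAt one_ne_zero)
      (differentiableAt_const 0) hw
    rw [fderiv_eta hdl hY.differentiableAt] at h
    have h2 := congrArg (fun L : E3 →L[ℝ] Mink => L w) hY.fderiv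
    simp only at h2
    rw [h2] at h
    simp [hz', eta_add_right, eta_smul_right, eta_neg_right] at h
    rw [eta_comm, real_inner_comm]
    linarith
  rw [key z w hz hw, key w z hw hz, hsymm, real_inner_comm]

/-- Gauss–Bonnet for the bundle of planes orthogonal to a null normal field `l` and to the constant
vector `t`. It is isometric to the tangent bundle by projection along `l`. As `t` is constant, only
the second fundamental form along `l` enters its curvature. -/
theorem integral_normalDet {l : E3 → Mink} {e₁ e₂ : E3 → E3}
    (hl : ∀ p ∈ sphere (0 : E3) 1, ContDiffAt ℝ ∞ l p)
    (ll : ∀ p ∈ sphere (0 : E3) 1, eta (l p) (l p) = 0)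
    (l0 : ∀ p ∈ sphere (0 : E3) 1, 0 < l p 0)
    (hn : ∀ p ∈ sphere (0 : E3) 1, ∀ v, IsTangent p v → eta (l p) (fderiv ℝ S.X p v) = 0)
    (h₁ : ∀ p ∈ sphere (0 : E3) 1, IsTangent p (e₁ p))
    (h₂ : ∀ p ∈ sphere (0 : E3) 1, IsTangent p (e₂ p))
    (h₁₁ : ∀ p ∈ sphere (0 : E3) 1, S.metric p (e₁ p) (e₁ p) = 1)
    (h₂₂ : ∀ p ∈ sphere (0 : E3) 1, S.metric p (e₂ p) (e₂ p) = 1)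
    (h₁₂ : ∀ p ∈ sphere (0 : E3) 1, S.metric p (e₁ p) (e₂ p) = 0)
    {t : Mink} (ht : 0 < eta t t) :
    ∫ p : sphere (0 : E3) 1, S.density p *
      ((eta (fderiv ℝ S.X p (e₁ p)) (fderiv ℝ l p (e₁ p)) *
          eta (fderiv ℝ S.X p (e₂ p)) (fderiv ℝ l p (e₂ p))
        - eta (fderiv ℝ S.X p (e₂ p)) (fderiv ℝ l p (e₁ p)) *
          eta (fderiv ℝ S.X p (e₁ p)) (fderiv ℝ l p (e₂ p))) / eta t (l p) ^ 2)
      ∂(volume : Measure E3).toSphere = 4 * Real.pi / eta t t := by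
  -- `k` is the multiple of `l` with `η(t, k) = 1`, and `n` the second null vector of the span of
  -- `k` and `t`; the isometric part of `dX` is moved into the complement of `t` by multiples of `l`
  have tl : ∀ p ∈ sphere (0 : E3) 1, eta t (l p) ≠ 0 := fun p hp =>
    eta_ne_zero_of_timelike_null ht (ll p hp) (l0 p hp)
  let g : E3 → ℝ := fun x => (eta t (l x))⁻¹
  have gtl : ∀ p ∈ sphere (0 : E3) 1, g p * eta t (l p) = 1 := fun p hp => inv_mul_cancel₀ (tl p hp)
  have hg : ∀ p ∈ sphere (0 : E3) 1, ContDiffAt ℝ ∞ g p := fun p hp =>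
    (contDiffAt_eta contDiffAt_const (hl p hp)).inv (tl p hp)
  have lI : ∀ p ∈ sphere (0 : E3) 1, ∀ k, eta (l p) (S.isometry k p) = 0 := fun p hp k =>
    S.eta_isometry_of_normal hp (hn p hp) k
  have lC : ∀ p ∈ sphere (0 : E3) 1, ∀ z, eta (l p) (columns S.isometry p z) = 0 :=
    fun p hp z => by simp [columns, eta_add_right, eta_smul_right, lI p hp]
  let k : E3 → Mink := fun x => g x • l x
  have hk : ∀ p ∈ sphere (0 : E3) 1, ContDiffAt ℝ ∞ k p := fun p hp => (hg p hp).smul (hl p hp)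
  let n : E3 → Mink := fun x => t - (eta t t / 2) • k x
  let F : Fin 3 → E3 → Mink := fun j x => S.isometry j x - (eta (S.isometry j x) t * g x) • l x
  have hcol : ∀ p z, columns F p z =
      columns S.isometry p z - (eta (columns S.isometry p z) t * g p) • l p := fun p z => by
    simp only [columns, F, eta_add_left, eta_smul_left]
    module
  have hF : IsTangentIsometry F :=
    { smooth := fun j p hp => (S.contDiffAt_isometry j hp).sub
        (((contDiffAt_eta (S.contDiffAt_isometry j hp) contDiffAt_const).mul (hg p hp)).smul
          (hl p hp))
      radial := fun p hp => by
        rw [hcol, S.isTangentIsometry.radial p hp, eta_zero_left]; simp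
      inner := fun p hp i j => by
        have := lI p hp i
        simp [F, eta_sub_left, eta_sub_right, eta_smul_left, eta_smul_right, lI p hp j, ll p hp,
          eta_comm (S.isometry i p) (l p), lI p hp i, S.isTangentIsometry.inner p hp] }
  have hdk : ∀ p ∈ sphere (0 : E3) 1, ∀ w,
      fderiv ℝ k p w = g p • fderiv ℝ l p w + fderiv ℝ g p w • l p := fun p hp w => by
    refine (congrArg (fun L : E3 →L[ℝ] Mink => L w)
      (((hg p hp).differentiableAt (by simp)).hasFDerivAt.smul
        ((hl p hp).differentiableAt (by simp)).hasFDerivAt).fderiv).trans ?_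
    simp
  have hdn : ∀ p ∈ sphere (0 : E3) 1, ∀ w,
      fderiv ℝ n p w = (-(eta t t / 2)) • fderiv ℝ k p w := fun p hp w => by
    refine (congrArg (fun L : E3 →L[ℝ] Mink => L w)
      ((hasFDerivAt_const t p).sub (((hk p hp).differentiableAt
        (by simp)).hasFDerivAt.const_smul (eta t t / 2))).fderiv).trans ?_
    simp
  have ldl : ∀ p ∈ sphere (0 : E3) 1, ∀ w, IsTangent p w → eta (l p) (fderiv ℝ l p w) = 0 := by
    intro p hp w hw
    have h := eta_fderiv_of_eqOn_const hp (hl p hp) (hl p hp) ll hw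
    rw [eta_comm (fderiv ℝ l p w)] at h
    linarith
  have hFk : ∀ p ∈ sphere (0 : E3) 1, ∀ z w, IsTangent p w →
      eta (columns F p z) (fderiv ℝ k p w) =
        g p * eta (columns S.isometry p z) (fderiv ℝ l p w) := fun p hp z w hw => by
    have h0 : eta (columns F p z) (l p) = 0 := by
      rw [hcol, eta_comm]
      simp [eta_sub_right, eta_smul_right, ll p hp, lC p hp]
    rw [hdk p hp, eta_add_right, eta_smul_right, eta_smul_right, h0, hcol, eta_sub_left,
      eta_smul_left, ldl p hp w hw]
    ring
  have kk : ∀ p ∈ sphere (0 : E3) 1, eta (k p) (k p) = 0 := fun p hp => by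
    simp [k, eta_smul_left, eta_smul_right, ll p hp]
  have tk : ∀ p ∈ sphere (0 : E3) 1, eta t (k p) = 1 := fun p hp => by
    simp only [k, eta_smul_right]; exact gtl p hp
  have res := hF.integral_mixedDet (l := k) (n := n) hk
    (fun p hp => contDiffAt_const.sub ((hk p hp).const_smul _)) kk
    (fun p hp => by
      simp only [n, eta_sub_left, eta_sub_right, eta_smul_left, eta_smul_right, kk p hp, tk p hp,
        eta_comm (k p) t]; ring)
    (fun p hp => by
      simp only [n, eta_sub_right, eta_smul_right, kk p hp, tk p hp, eta_comm (k p) t]; ring)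
    (fun p hp j => by
      simp [F, k, eta_sub_right, eta_smul_left, eta_smul_right, lI p hp, ll p hp])
    (fun p hp j => by
      simp only [F, n, k, eta_sub_left, eta_sub_right, eta_smul_left, eta_smul_right, lI p hp,
        ll p hp, eta_comm t (S.isometry j p)]
      linear_combination (-eta (S.isometry j p) t) * gtl p hp)
    (fun p => -eta t t * (S.density p *
      ((eta (fderiv ℝ S.X p (e₁ p)) (fderiv ℝ l p (e₁ p)) *
          eta (fderiv ℝ S.X p (e₂ p)) (fderiv ℝ l p (e₂ p))
        - eta (fderiv ℝ S.X p (e₂ p)) (fderiv ℝ l p (e₁ p)) *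
          eta (fderiv ℝ S.X p (e₁ p)) (fderiv ℝ l p (e₂ p))) / eta t (l p) ^ 2)))
    (fun p u v h => by
      have hm := mixedDet_isometry (S := S) p.2 h (h₁ p p.2) (h₂ p p.2) (h₁₁ p p.2) (h₂₂ p p.2)
        (h₁₂ p p.2) (fderiv ℝ l p) (fderiv ℝ l p)
      have hu := h.tangent_left
      have hv := h.tangent_right
      simp only [mixedDet] at hm
      simp only [mixedDet, hdn p p.2, eta_smul_right, hFk p p.2 _ _ hu, hFk p p.2 _ _ hv]
      rw [div_eq_mul_inv, ← inv_pow]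
      change -eta t t * (S.density p * (_ * g p ^ 2)) = _
      linear_combination (eta t t / 2 * g p ^ 2) * hm)
  have h := res.2
  rw [integral_const_mul] at h
  rw [eq_div_iff ht.ne']
  linarith

end SpacelikeSphere

/-! ### Spin coefficients -/

theorem det_combination (n x y l : Mink) (a b c e : ℝ) :
    (Matrix.of ![n, a • x + b • y, c • x + e • y, l]).det =
      (a * e - b * c) * (Matrix.of ![n, x, y, l]).det := by
  simp [Matrix.det_succ_row_zero, Fin.sum_univ_succ, Fin.succAbove]
  ring

theorem eta_complex_combination (a b c d : Mink) (κ μ : ℂ) :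
    eta (fun i => ((a i : ℂ) + κ * (b i : ℂ)) / (Real.sqrt 2 : ℂ))
      (fun i => ((c i : ℂ) + μ * (d i : ℂ)) / (Real.sqrt 2 : ℂ)) =
    ((eta a c : ℝ) + μ * (eta a d : ℝ) + κ * (eta b c : ℝ) + κ * μ * (eta b d : ℝ)) / 2 := by
  have h : (Real.sqrt 2 : ℂ) * (Real.sqrt 2 : ℂ) = 2 := by
    rw [← Complex.ofReal_mul, Real.mul_self_sqrt (by norm_num)]; norm_num
  simp only [eta, div_mul_div_comm, h]
  push_cast
  ring

namespace NullTetrad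

variable {S : SpacelikeSphere} (T : NullTetrad S)

theorem rho_eq (p : E3) : T.rho p =
    ((eta (fderiv ℝ S.X p (T.e₁ p)) (fderiv ℝ T.l p (T.e₁ p)) : ℝ)
      + (-Complex.I) * (eta (fderiv ℝ S.X p (T.e₁ p)) (fderiv ℝ T.l p (T.e₂ p)) : ℝ)
      + Complex.I * (eta (fderiv ℝ S.X p (T.e₂ p)) (fderiv ℝ T.l p (T.e₁ p)) : ℝ)
      + Complex.I * (-Complex.I) *
        (eta (fderiv ℝ S.X p (T.e₂ p)) (fderiv ℝ T.l p (T.e₂ p)) : ℝ)) / 2 := by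
  rw [← eta_complex_combination]
  simp only [neg_mul, ← sub_eq_add_neg]
  rfl

theorem sigma_eq (p : E3) : T.sigma p =
    ((eta (fderiv ℝ S.X p (T.e₁ p)) (fderiv ℝ T.l p (T.e₁ p)) : ℝ)
      + Complex.I * (eta (fderiv ℝ S.X p (T.e₁ p)) (fderiv ℝ T.l p (T.e₂ p)) : ℝ)
      + Complex.I * (eta (fderiv ℝ S.X p (T.e₂ p)) (fderiv ℝ T.l p (T.e₁ p)) : ℝ)
      + Complex.I * Complex.I *
        (eta (fderiv ℝ S.X p (T.e₂ p)) (fderiv ℝ T.l p (T.e₂ p)) : ℝ)) / 2 := by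
  rw [← eta_complex_combination]
  rfl

theorem rho'_eq (p : E3) : T.rho' p =
    ((eta (fderiv ℝ S.X p (T.e₁ p)) (fderiv ℝ T.n p (T.e₁ p)) : ℝ)
      + Complex.I * (eta (fderiv ℝ S.X p (T.e₁ p)) (fderiv ℝ T.n p (T.e₂ p)) : ℝ)
      + (-Complex.I) * (eta (fderiv ℝ S.X p (T.e₂ p)) (fderiv ℝ T.n p (T.e₁ p)) : ℝ)
      + (-Complex.I) * Complex.I *
        (eta (fderiv ℝ S.X p (T.e₂ p)) (fderiv ℝ T.n p (T.e₂ p)) : ℝ)) / 2 := by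
  rw [← eta_complex_combination]
  simp only [neg_mul, ← sub_eq_add_neg]
  rfl

theorem sigma'_eq (p : E3) : T.sigma' p =
    ((eta (fderiv ℝ S.X p (T.e₁ p)) (fderiv ℝ T.n p (T.e₁ p)) : ℝ)
      + (-Complex.I) * (eta (fderiv ℝ S.X p (T.e₁ p)) (fderiv ℝ T.n p (T.e₂ p)) : ℝ)
      + (-Complex.I) * (eta (fderiv ℝ S.X p (T.e₂ p)) (fderiv ℝ T.n p (T.e₁ p)) : ℝ)
      + (-Complex.I) * (-Complex.I) *
        (eta (fderiv ℝ S.X p (T.e₂ p)) (fderiv ℝ T.n p (T.e₂ p)) : ℝ)) / 2 := by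
  rw [← eta_complex_combination]
  simp only [neg_mul, ← sub_eq_add_neg]
  rfl

theorem rho_sq_sub (p : sphere (0 : E3) 1) :
    T.rho p ^ 2 - T.sigma p * (starRingEnd ℂ) (T.sigma p) =
      ((eta (fderiv ℝ S.X p (T.e₁ p)) (fderiv ℝ T.l p (T.e₁ p)) *
          eta (fderiv ℝ S.X p (T.e₂ p)) (fderiv ℝ T.l p (T.e₂ p))
        - eta (fderiv ℝ S.X p (T.e₂ p)) (fderiv ℝ T.l p (T.e₁ p)) *
          eta (fderiv ℝ S.X p (T.e₁ p)) (fderiv ℝ T.l p (T.e₂ p)) : ℝ) : ℂ) := by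
  rw [rho_eq, sigma_eq, S.eta_fderiv_symm T.l_smooth T.l_normal p.2 (T.e₂_tangent p p.2)
    (T.e₁_tangent p p.2)]
  simp only [map_div₀, map_add, map_mul, Complex.conj_I, Complex.conj_ofReal, map_ofNat]
  push_cast
  ring_nf
  simp only [Complex.I_sq]
  ring

theorem rho'_sq_sub (p : sphere (0 : E3) 1) :
    T.rho' p ^ 2 - T.sigma' p * (starRingEnd ℂ) (T.sigma' p) =
      ((eta (fderiv ℝ S.X p (T.e₁ p)) (fderiv ℝ T.n p (T.e₁ p)) *
          eta (fderiv ℝ S.X p (T.e₂ p)) (fderiv ℝ T.n p (T.e₂ p))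
        - eta (fderiv ℝ S.X p (T.e₂ p)) (fderiv ℝ T.n p (T.e₁ p)) *
          eta (fderiv ℝ S.X p (T.e₁ p)) (fderiv ℝ T.n p (T.e₂ p)) : ℝ) : ℂ) := by
  rw [rho'_eq, sigma'_eq, S.eta_fderiv_symm T.n_smooth T.n_normal p.2 (T.e₂_tangent p p.2)
    (T.e₁_tangent p p.2)]
  simp only [map_div₀, map_add, map_mul, map_neg, Complex.conj_I, Complex.conj_ofReal, map_ofNat]
  push_cast
  ring_nf
  simp only [Complex.I_sq]
  ring

/-- The real part of `-ρρ' + σσ'` is half the Gauss curvature, the imaginary part is given by the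
curvature of the normal bundle, the exterior derivative of `n_a dℓ^a`. -/
theorem neg_rho_mul_add_sigma_mul (p : sphere (0 : E3) 1) :
    -(T.rho p * T.rho' p) + T.sigma p * T.sigma' p =
      ((-(1 / 2) * mixedDet (fderiv ℝ S.X p (T.e₁ p)) (fderiv ℝ S.X p (T.e₂ p))
        (fderiv ℝ T.l p (T.e₁ p)) (fderiv ℝ T.l p (T.e₂ p))
        (fderiv ℝ T.n p (T.e₁ p)) (fderiv ℝ T.n p (T.e₂ p)) : ℝ) : ℂ)
      + Complex.I * ((-(1 / 2) * (eta (fderiv ℝ T.n p (T.e₁ p)) (fderiv ℝ T.l p (T.e₂ p))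
        - eta (fderiv ℝ T.n p (T.e₂ p)) (fderiv ℝ T.l p (T.e₁ p))) : ℝ) : ℂ) := by
  have hp := p.2
  have h₁ := T.e₁_tangent p hp
  have h₂ := T.e₂_tangent p hp
  have sl := S.eta_fderiv_symm T.l_smooth T.l_normal hp h₂ h₁
  have sn := S.eta_fderiv_symm T.n_smooth T.n_normal hp h₂ h₁
  have ldl : ∀ w, IsTangent (p : E3) w → eta (fderiv ℝ T.l p w) (T.l p) = 0 := by
    intro w hw
    have h := eta_fderiv_of_eqOn_const hp (T.l_smooth p hp) (T.l_smooth p hp) T.l_null hw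
    rw [eta_comm (T.l p)] at h
    linarith
  have ldn : ∀ w, IsTangent (p : E3) w →
      eta (fderiv ℝ T.n p w) (T.l p) = -eta (fderiv ℝ T.l p w) (T.n p) := by
    intro w hw
    have h := eta_fderiv_of_eqOn_const hp (T.l_smooth p hp) (T.n_smooth p hp) T.l_n hw
    rw [eta_comm (T.l p)] at h
    linarith
  have hu : ∀ v, eta (fderiv ℝ S.X p v) (fderiv ℝ S.X p v) = -S.metric p v v := fun v => by
    simp [SpacelikeSphere.metric]
  have h12 : eta (fderiv ℝ S.X p (T.e₁ p)) (fderiv ℝ S.X p (T.e₂ p)) = 0 := by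
    have := T.e₁_e₂ p hp
    rw [SpacelikeSphere.metric] at this
    linarith
  have cpl := eta_eq_of_null_frame (T.l_null p hp) (T.n_null p hp) (T.l_n p hp)
    (T.l_normal p hp _ h₁) (T.l_normal p hp _ h₂) (T.n_normal p hp _ h₁) (T.n_normal p hp _ h₂)
    (by rw [hu, T.e₁_unit p hp]) (by rw [hu, T.e₂_unit p hp]) h12
  rw [rho_eq, sigma_eq, rho'_eq, sigma'_eq, mixedDet,
    cpl (fderiv ℝ T.n p (T.e₁ p)) (fderiv ℝ T.l p (T.e₂ p)),
    cpl (fderiv ℝ T.n p (T.e₂ p)) (fderiv ℝ T.l p (T.e₁ p)), ldl _ h₁, ldl _ h₂, ldn _ h₁,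
    ldn _ h₂]
  simp only [eta_comm _ (fderiv ℝ S.X p (T.e₁ p)), eta_comm _ (fderiv ℝ S.X p (T.e₂ p)), sl, sn]
  push_cast
  ring_nf
  simp only [Complex.I_sq, show Complex.I ^ 3 = -Complex.I by rw [pow_succ, Complex.I_sq]; ring]
  ring

/-! ### The curvature of the normal bundle and the three integrals -/

/-- The determinant of `(n, dX u, dX v, ℓ)` for an oriented orthonormal frame `u, v` of the
parameter sphere. Its sign compares the orientation of the parameter sphere with that of the
tetrad. -/
def orientation (p : E3) : ℝ :=
  p 0 * (Matrix.of ![T.n p, S.tangentField 1 p, S.tangentField 2 p, T.l p]).det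
  + p 1 * (Matrix.of ![T.n p, S.tangentField 2 p, S.tangentField 0 p, T.l p]).det
  + p 2 * (Matrix.of ![T.n p, S.tangentField 0 p, S.tangentField 1 p, T.l p]).det

theorem orientation_eq {p u v : E3} (h : IsFrame p u v) : T.orientation p =
    (Matrix.of ![T.n p, fderiv ℝ S.X p u, fderiv ℝ S.X p v, T.l p]).det := by
  simp only [orientation, SpacelikeSphere.tangentField_eq h, det_combination]
  linear_combination (Matrix.of ![T.n p, fderiv ℝ S.X p u, fderiv ℝ S.X p v, T.l p]).det *
    (h.pp - p 0 * h.p0 - p 1 * h.p1 - p 2 * h.p2)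

theorem continuous_orientation : Continuous fun p : sphere (0 : E3) 1 => T.orientation p := by
  have hn := continuous_sphere_of_contDiffAt T.n_smooth
  have hl := continuous_sphere_of_contDiffAt T.l_smooth
  have hY : ∀ k, Continuous fun p : sphere (0 : E3) 1 => S.tangentField k p := fun k =>
    continuous_sphere_of_contDiffAt fun p hp => S.contDiffAt_tangentField k hp
  have hi : ∀ i : Fin 3, Continuous fun p : sphere (0 : E3) 1 => (p : E3) i := fun i =>
    (EuclideanSpace.proj (𝕜 := ℝ) i : E3 →L[ℝ] ℝ).continuous.comp continuous_subtype_val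
  have hD : ∀ j k, Continuous fun p : sphere (0 : E3) 1 =>
      (Matrix.of ![T.n p, S.tangentField j p, S.tangentField k p, T.l p]).det := fun j k => by
    refine Continuous.matrix_det (continuous_pi fun i => ?_)
    fin_cases i
    · exact hn
    · exact hY j
    · exact hY k
    · exact hl
  exact (((hi 0).mul (hD 1 2)).add ((hi 1).mul (hD 2 0))).add ((hi 2).mul (hD 0 1))

/-- The curvature of the normal bundle is, up to a sign that is constant because the sphere is
connected, the exterior derivative of the globally defined one-form `n_a dℓ^a`. -/
theorem exists_normalCurvature_eq : ∃ ε : ℝ, ∀ p : sphere (0 : E3) 1,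
    S.density p * (eta (fderiv ℝ T.n p (T.e₁ p)) (fderiv ℝ T.l p (T.e₂ p))
        - eta (fderiv ℝ T.n p (T.e₂ p)) (fderiv ℝ T.l p (T.e₁ p))) =
      ε * etaBracket T.n T.l p := by
  -- `Δ` is the determinant of the change of frame
  have key : ∀ p : sphere (0 : E3) 1, ∃ Δ : ℝ, 0 < Δ * T.orientation p ∧
      (S.density p * Δ) ^ 2 = 1 ∧ 0 < S.density p ∧
      eta (fderiv ℝ T.n p (T.e₁ p)) (fderiv ℝ T.l p (T.e₂ p))
        - eta (fderiv ℝ T.n p (T.e₂ p)) (fderiv ℝ T.l p (T.e₁ p)) =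
      Δ * etaBracket T.n T.l p := by
    intro p
    have hp := p.2
    obtain ⟨u, v, h⟩ := exists_isFrame hp
    have E₁ := h.eq_combination (T.e₁_tangent p hp)
    have E₂ := h.eq_combination (T.e₂_tangent p hp)
    have ho := T.oriented p hp
    have hg : S.gram p (T.e₁ p) (T.e₂ p) = 1 := by
      rw [SpacelikeSphere.gram, S.metric_comm p (T.e₂ p), T.e₁_unit p hp, T.e₂_unit p hp,
        T.e₁_e₂ p hp]
      norm_num
    generalize ⟪u, T.e₁ p⟫ = a at E₁
    generalize ⟪v, T.e₁ p⟫ = b at E₁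
    generalize ⟪u, T.e₂ p⟫ = c at E₂
    generalize ⟪v, T.e₂ p⟫ = e at E₂
    rw [E₁, E₂, S.gram_combination, ← SpacelikeSphere.density_sq hp h] at hg
    rw [E₁, E₂, map_add, map_add, map_smul, map_smul, map_smul, map_smul, det_combination] at ho
    refine ⟨a * e - b * c, ?_, ?_, SpacelikeSphere.density_pos hp h, ?_⟩
    · rwa [orientation_eq T h]
    · rw [mul_pow, mul_comm]; exact hg
    · rw [h.etaBracket_eq ((T.n_smooth p hp).differentiableAt (by simp))
        ((T.l_smooth p hp).differentiableAt (by simp)), E₁, E₂]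
      simp only [map_add, map_smul, eta_add_left, eta_add_right, eta_smul_left, eta_smul_right]
      ring
  have hconn : PreconnectedSpace (sphere (0 : E3) 1) :=
    isPreconnected_iff_preconnectedSpace.1 (isPreconnected_sphere (by
      rw [← Module.finrank_eq_rank]; norm_num) 0 1)
  have hne : ∀ p : sphere (0 : E3) 1, T.orientation p ≠ 0 := fun p h0 => by
    obtain ⟨Δ, h1, -⟩ := key p
    rw [h0, mul_zero] at h1
    exact lt_irrefl _ h1
  have hsign : (∀ p : sphere (0 : E3) 1, 0 < T.orientation p) ∨
      (∀ p : sphere (0 : E3) 1, T.orientation p < 0) := by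
    by_contra! hcon
    obtain ⟨⟨p, hp⟩, ⟨q, hq⟩⟩ := hcon
    obtain ⟨r, hr⟩ := mem_range_of_exists_le_of_exists_ge T.continuous_orientation ⟨p, hp⟩ ⟨q, hq⟩
    exact hne r hr
  rcases hsign with hs | hs
  · refine ⟨1, fun p => ?_⟩
    obtain ⟨Δ, h1, h2, h3, h4⟩ := key p
    have hΔ : 0 < Δ := pos_of_mul_pos_left h1 (hs p).le
    have : S.density p * Δ = 1 := by
      nlinarith [mul_pos h3 hΔ]
    rw [h4, ← mul_assoc, this]
  · refine ⟨-1, fun p => ?_⟩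
    obtain ⟨Δ, h1, h2, h3, h4⟩ := key p
    have hΔ : Δ < 0 := neg_of_mul_pos_left h1 (hs p).le
    have : S.density p * Δ = -1 := by
      nlinarith [mul_neg_of_pos_of_neg h3 hΔ]
    rw [h4, ← mul_assoc, this]

theorem integral_rho {t : Mink} (ht : 0 < eta t t) :
    ∫ p : sphere (0 : E3) 1, (T.rho p ^ 2 - T.sigma p * (starRingEnd ℂ) (T.sigma p)) /
      ((eta t (T.l p) : ℝ) : ℂ) ^ 2 ∂S.area = 4 * (Real.pi : ℂ) / ((eta t t : ℝ) : ℂ) := by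
  have h := S.integral_normalDet T.l_smooth T.l_null T.l_future T.l_normal T.e₁_tangent
    T.e₂_tangent T.e₁_unit T.e₂_unit T.e₁_e₂ ht
  rw [S.integral_area]
  simp only [rho_sq_sub]
  have h' := congrArg (fun r : ℝ => (r : ℂ)) h
  simp only [← integral_complex_ofReal] at h'
  push_cast at h' ⊢
  exact h'

theorem integral_rho' {t : Mink} (ht : 0 < eta t t) :
    ∫ p : sphere (0 : E3) 1, (T.rho' p ^ 2 - T.sigma' p * (starRingEnd ℂ) (T.sigma' p)) /
      ((eta t (T.n p) : ℝ) : ℂ) ^ 2 ∂S.area = 4 * (Real.pi : ℂ) / ((eta t t : ℝ) : ℂ) := by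
  have h := S.integral_normalDet T.n_smooth T.n_null T.n_future T.n_normal T.e₁_tangent
    T.e₂_tangent T.e₁_unit T.e₂_unit T.e₁_e₂ ht
  rw [S.integral_area]
  simp only [rho'_sq_sub]
  have h' := congrArg (fun r : ℝ => (r : ℂ)) h
  simp only [← integral_complex_ofReal] at h'
  push_cast at h' ⊢
  exact h'

theorem integral_curvature :
    ∫ p : sphere (0 : E3) 1, (-(T.rho p * T.rho' p) + T.sigma p * T.sigma' p) ∂S.area =
      2 * (Real.pi : ℂ) := by
  obtain ⟨ε, hε⟩ := T.exists_normalCurvature_eq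
  obtain ⟨hi, h0⟩ := S.isTangentIsometry.integral_mixedDet T.l_smooth T.n_smooth T.l_null T.n_null
    T.l_n (fun p hp => S.eta_isometry_of_normal hp (T.l_normal p hp))
    (fun p hp => S.eta_isometry_of_normal hp (T.n_normal p hp))
    (fun p => S.density p * mixedDet (fderiv ℝ S.X p (T.e₁ p)) (fderiv ℝ S.X p (T.e₂ p))
        (fderiv ℝ T.l p (T.e₁ p)) (fderiv ℝ T.l p (T.e₂ p))
        (fderiv ℝ T.n p (T.e₁ p)) (fderiv ℝ T.n p (T.e₂ p)))
    (fun p u v h => (SpacelikeSphere.mixedDet_isometry p.2 h (T.e₁_tangent p p.2)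
      (T.e₂_tangent p p.2) (T.e₁_unit p p.2) (T.e₂_unit p p.2) (T.e₁_e₂ p p.2) _ _).symm)
  have hb := integrable_etaBracket T.n_smooth T.l_smooth
  have hb0 := integral_etaBracket T.n_smooth T.l_smooth
  rw [S.integral_area]
  have e : ∀ p : sphere (0 : E3) 1,
      (S.density p : ℂ) * (-(T.rho p * T.rho' p) + T.sigma p * T.sigma' p) =
      ((-(1 / 2) * (S.density p * mixedDet (fderiv ℝ S.X p (T.e₁ p)) (fderiv ℝ S.X p (T.e₂ p))
        (fderiv ℝ T.l p (T.e₁ p)) (fderiv ℝ T.l p (T.e₂ p))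
        (fderiv ℝ T.n p (T.e₁ p)) (fderiv ℝ T.n p (T.e₂ p))) : ℝ) : ℂ)
      + Complex.I * ((-(1 / 2) * ε * etaBracket T.n T.l p : ℝ) : ℂ) := by
    intro p
    rw [neg_rho_mul_add_sigma_mul, mul_assoc (-(1 / 2) : ℝ) ε, ← hε p]
    push_cast
    ring
  simp only [e]
  rw [integral_add (hi.const_mul _).ofReal ((hb.const_mul _).ofReal.const_mul _),
    integral_const_mul, integral_complex_ofReal, integral_complex_ofReal, integral_const_mul,
    integral_const_mul, h0, hb0]
  push_cast
  ring

end NullTetrad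

end SpacelikeTwoSphere

end

open SpacelikeTwoSphere in
theorem proposition4p3 (S : SpacelikeSphere) (T : NullTetrad S) (t : Mink) (ht : 0 < eta t t) :
    (∫ p : Metric.sphere (0 : E3) 1,
        (T.rho p ^ 2 - T.sigma p * (starRingEnd ℂ) (T.sigma p)) / ((eta t (T.l p) : ℝ) : ℂ) ^ 2 ∂S.area
      = 4 * (Real.pi : ℂ) / ((eta t t : ℝ) : ℂ)) ∧
    (∫ p : Metric.sphere (0 : E3) 1,
        (T.rho' p ^ 2 - T.sigma' p * (starRingEnd ℂ) (T.sigma' p)) / ((eta t (T.n p) : ℝ) : ℂ) ^ 2 ∂S.area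
      = 4 * (Real.pi : ℂ) / ((eta t t : ℝ) : ℂ)) ∧
    (∫ p : Metric.sphere (0 : E3) 1,
        (-(T.rho p * T.rho' p) + T.sigma p * T.sigma' p) ∂S.area
      = 2 * (Real.pi : ℂ)) :=
  ⟨T.integral_rho ht, T.integral_rho' ht, T.integral_curvature⟩
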